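/- Let $(R,\mathfrak m,k)$ be a one-dimensional Noetherian local domain with infinite residue field $k$ and fraction field $K$, such that the integral closure $\overline R$ of $R$ in $K$ is a finite $R$-module and a discrete valuation ring with normalized valuation $v$, and such that the natural map from $k$ to the residue field of $\overline R$ is an isomorphism. Write $\ell=\ell_R$ for length, $I:J=\{x\in K\mid xJ\subseteq I\}$ and $I^*=R:I$ for fractional ideals, and $v(J)=\{v(y)\mid 0\ne y\in J\}$. A canonical module of $R$ is a nonzero fractional ideal $\omega$ with $\omega:(\omega:J)=J$ for all nonzero fractional ideals $J$; $R$ is Gorenstein if $R$ is a canonical module of itself. Let $\Lambda=\bigcup_{n\ge 0}(\mathfrak m^n:\mathfrak m^n)$ be the blowing-up of $R$ along $\mathfrak m$. Let $e=h(1)$ be the multiplicity of $R$, where $h\in\mathbb Z[z]$ is the polynomial with $\sum_{n\ge 0}\ell(\mathfrak m^n/\mathfrak m^{n+1})z^n=h(z)/(1-z)$; let $\mu=\dim_k\mathfrak m/\mathfrak m^2$; and let $\nu$ be the reduction exponent of $\mathfrak m$, i.e. the least integer $\nu$ such that for some $x\in\mathfrak m$ one has $\mathfrak m^{n+1}=x\,\mathfrak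 m^n$ for all $n\ge\nu$. Put $\gamma=R:\overline R$, $c=\ell(\overline R/\gamma)$, $\delta=\ell(\overline R/R)$, $n=c-\delta=\ell(R/\gamma)$. Let $0=s_0<s_1<s_2<\cdots$ be the elements of $v(R)$, let $R_i=\{a\in R\mid v(a)\ge s_i\}$, and let $r_i=\ell\big((R:R_i)/(R:R_{i-1})\big)$ for $1\le i\le n$ (the type sequence of $R$). $R$ is almost Gorenstein if $r_1-1=2\delta-c$. Put $\Gamma=\{i\in\{1,\dots,n\}\mid s_{i-1}\in v(R:\Lambda)\}$ and $d(R:\Lambda)=\ell(\overline R/\Lambda^{**})-\sum_{i\in\Gamma}r_i$. Suppose $e=\mu+1$. Then: (1) $R:\Lambda=\mathfrak m^\nu$ if and only if $R$ is Gorenstein and $\nu=2$. (2) $\displaystyle\sum_{1\le i\le n,\ i\notin\Gamma,\ i\ne 1}(r_i-1)=d(R:\Lambda)+\ell(\Lambda^{**}/\Lambda)+(\nu-2)$. (3) For every canonical module $\omega$ of $R$ with $R\subseteq\omega\subseteq\overline R$: $R$ is almost Gorenstein if and only if $\nu=2$ and $\omega\Lambda=\Lambda$. -/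

import Mathlib

noncomputable section

namespace CurveSing

open IsLocalRing

section General

variable {R : Type*} [CommRing R]

/-- The length `ℓ_R(A / B)` of the quotient of two submodules `B ⊆ A`, as a natural number
(it is only used below for quotients of finite length). -/
def len {M : Type*} [AddCommGroup M] [Module R M] (A B : Submodule R M) : ℕ :=
  (Module.length R (A ⧸ B.submoduleOf A)).toNat

/-- The Hilbert function `H_I(n) = ℓ_R(I^n / I^(n+1))`. -/
def hilbertFun (I : Ideal R) (n : ℕ) : ℕ := len (I ^ n) (I ^ (n + 1))

/-- The Hilbert-Poincaré series `P_I(z) = ∑ H_I(n) z^n`. -/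
def hilbertSeries (I : Ideal R) : PowerSeries ℤ :=
  PowerSeries.mk fun n => (hilbertFun I n : ℤ)

open Classical in
/-- The `h`-polynomial of `I`: the (unique) polynomial `h` with `P_I(z) = h(z) / (1 - z)`. -/
def hPoly (I : Ideal R) : Polynomial ℤ :=
  if h : ∃ p : Polynomial ℤ,
      (p : PowerSeries ℤ) = (1 - (PowerSeries.X : PowerSeries ℤ)) * hilbertSeries I
    then h.choose else 0

/-- The multiplicity `e(I) = h_I(1)`. -/
def mult (I : Ideal R) : ℤ := (hPoly I).eval 1

/-- The reduction exponent `ν(I)`: the least `k` such that, for some `x ∈ I`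
(a minimal reduction of `I`), `I^(n+1) = x I^n` for all `n ≥ k`. -/
def reductionExponent (I : Ideal R) : ℕ :=
  sInf {k : ℕ | ∃ x ∈ I, ∀ n ≥ k, I ^ (n + 1) = Ideal.span {x} * I ^ n}

/-- The embedding dimension `μ = dim_k 𝔪/𝔪²`. -/
def embDim (R : Type*) [CommRing R] [IsLocalRing R] : ℕ :=
  Module.finrank (ResidueField R) (CotangentSpace R)

end General

/-! Fractional ideals of `R` are regarded as `R`-submodules of the fraction field `K`.
For submodules, `I / J` is Mathlib's colon `{x ∈ K | x J ⊆ I}`, and `1` is the image of `R`. -/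

section Fractional

variable {R : Type*} [CommRing R] (K : Type*) [Field K] [Algebra R K]

/-- The integral closure of `R` in `K`, as an `R`-submodule of `K`. -/
def Rbar (R : Type*) [CommRing R] (K : Type*) [Field K] [Algebra R K] : Submodule R K :=
  Subalgebra.toSubmodule (integralClosure R K)

/-- An ideal of `R` as an `R`-submodule of `K`. -/
def frac (I : Ideal R) : Submodule R K := IsLocalization.coeSubmodule K I

/-- The blowing-up `Λ(I) = ⋃ₙ (Iⁿ : Iⁿ)`; the union is increasing, so it is the supremum. -/
def blowup (I : Ideal R) : Submodule R K := ⨆ n : ℕ, (frac K I ^ n) / (frac K I ^ n)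

variable {K}

/-- The dual `I^* = R : I`. -/
def dual (I : Submodule R K) : Submodule R K := 1 / I

/-- `ω` is a canonical module of `R`, realized as a fractional ideal: a nonzero fractional ideal
with `ω : (ω : I) = I` for every nonzero fractional ideal `I`. -/
def IsCanonicalIdeal (ω : Submodule R K) : Prop :=
  ω ≠ ⊥ ∧ ω.FG ∧ ∀ I : Submodule R K, I ≠ ⊥ → I.FG → ω / (ω / I) = I

/-- `R` is Gorenstein: `R` is a canonical module of itself. -/
def IsGorenstein (R : Type*) [CommRing R] (K : Type*) [Field K] [Algebra R K] : Prop :=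
  IsCanonicalIdeal (1 : Submodule R K)

end Fractional

section Invariants

variable (R : Type*) [CommRing R] (K : Type*) [Field K] [Algebra R K]

/-- The conductor ideal `γ_R = R : R̄`. -/
def condIdeal : Submodule R K := 1 / Rbar R K

/-- `c = ℓ_R(R̄ / γ_R)`. -/
def cond : ℕ := len (Rbar R K) (condIdeal R K)

/-- The singularity degree `δ = ℓ_R(R̄ / R)`. -/
def delta : ℕ := len (Rbar R K) 1

/-- `n = c - δ = ℓ_R(R / γ_R)`, the length of the type sequence. -/
def numTS : ℕ := len 1 (condIdeal R K)

/-- `R` is residually rational: the natural map from the residue field of `R` to that of the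
integral closure is an isomorphism (equivalently, surjective after composing with `R → k`). -/
def ResiduallyRational [IsLocalRing (integralClosure R K)] : Prop :=
  Function.Surjective
    ((residue (integralClosure R K)).comp (algebraMap R (integralClosure R K)))

variable [IsDiscreteValuationRing (integralClosure R K)]

variable {R K} in
/-- The set of values `v(M)` of the nonzero elements of `M`, for an `R`-submodule `M` of the
integral closure, where `v` is the normalized valuation of the integral closure. -/
def values (M : Submodule R K) : Set ℕ :=
  {n | ∃ y : integralClosure R K, (y : K) ∈ M ∧
    IsDiscreteValuationRing.addVal (integralClosure R K) y = (n : ℕ∞)}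

/-- `s_i`, where `s_0 = 0 < s_1 < s_2 < ⋯` are the elements of the semigroup `v(R)`. -/
def sElem (i : ℕ) : ℕ := Nat.nth (fun a => a ∈ values (1 : Submodule R K)) i

/-- The ideal `R_i = {a ∈ R | v(a) ≥ s_i}`. -/
def idealR (i : ℕ) : Ideal R where
  carrier := {a | (sElem R K i : ℕ∞) ≤
    IsDiscreteValuationRing.addVal (integralClosure R K) (algebraMap R (integralClosure R K) a)}
  add_mem' {a b} ha hb := by
    simp only [Set.mem_ofPred_eq, map_add] at ha hb ⊢
    exact le_trans (le_min ha hb) (IsDiscreteValuationRing.addVal_add)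
  zero_mem' := by simp
  smul_mem' r a ha := by
    simp only [Set.mem_ofPred_eq, smul_eq_mul, map_mul,
      IsDiscreteValuationRing.addVal_mul] at ha ⊢
    exact le_trans ha le_add_self

/-- The type sequence: `r_i = ℓ_R((R : R_i) / (R : R_{i-1}))`, for `i = 1, …, n`. -/
def typeSeq (i : ℕ) : ℕ :=
  len (dual (frac K (idealR R K i))) (dual (frac K (idealR R K (i - 1))))

/-- `R` is almost Gorenstein: `r_1 - 1 = 2 δ - c`. -/
def IsAlmostGorenstein : Prop :=
  (typeSeq R K 1 : ℤ) - 1 = 2 * (delta R K : ℤ) - (cond R K : ℤ)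

variable {R}

open Classical in
/-- `Γ = {i ∈ {1, …, n} | s_{i-1} ∈ v(R : Λ)}`, where `Λ = Λ(I)`. -/
def Gam (I : Ideal R) : Finset ℕ :=
  (Finset.Icc 1 (numTS R K)).filter fun i => sElem R K (i - 1) ∈ values (dual (blowup K I))

/-- `d(R : Λ) = ℓ_R(R̄ / Λ^**) - ∑_{i ∈ Γ} r_i`, where `Λ = Λ(I)`. -/
def dInv (I : Ideal R) : ℤ :=
  (len (Rbar R K) (dual (dual (blowup K I))) : ℤ) - ∑ i ∈ Gam K I, (typeSeq R K i : ℤ)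

end Invariants

end CurveSing

end

/-!
Let `x ∈ 𝔪` have minimal value and put `N = x⁻¹𝔪`. The blowing-up `Λ` is the stable power `N ^ ν`,
and comparing `𝔪ⁿ` with `x𝔪ⁿ` gives `ℓ(𝔪ⁿ / 𝔪ⁿ⁺¹) + ℓ(Nⁿ⁺¹ / Nⁿ) = ℓ(R / xR) = e` for all `n`.
For `n = 1`, the equation `e = μ + 1` says that `N² / N` is simple; then each `Nⁿ⁺¹ / Nⁿ` is simple
until the powers stabilise, and `ℓ(Λ / R) = e + ν - 2`. Let `P` be the set of elements of positive
value in `R : 𝔪`. They act nilpotently, hence trivially, on the simple module `N² / N`; this yields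
`PΛ ⊆ P`, then `R : Λ = xP`, and `ℓ(R / (R : Λ)) = e + 1 - r₁`. The three claims follow from
these two lengths.
-/

noncomputable section

namespace CurveSing

open IsLocalRing

section Length

variable {R : Type*} [CommRing R] {M N : Type*} [AddCommGroup M] [Module R M] [AddCommGroup N]
  [Module R N]

/-- The length of `A / B` with values in `ℕ∞`; `len` is its truncation to `ℕ`. -/
def relLength (A B : Submodule R M) : ℕ∞ := Module.length R (A ⧸ B.submoduleOf A)

theorem relLength_eq_zero_iff {A B : Submodule R M} : relLength A B = 0 ↔ A ≤ B := by
  rw [relLength, Module.length_eq_zero_iff, Submodule.Quotient.subsingleton_iff,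
    Submodule.submoduleOf_eq_top]

theorem relLength_eq_one_iff {A B : Submodule R M} (h : B ≤ A) : relLength A B = 1 ↔ B ⋖ A := by
  rw [relLength, Module.length_eq_one_iff, covBy_iff_quot_is_simple h]
  rfl

theorem relLength_add {A B C : Submodule R M} (hBA : B ≤ A) (hCB : C ≤ B) :
    relLength A B + relLength B C = relLength A C := by
  let f : (B ⧸ C.submoduleOf B) →ₗ[R] A ⧸ C.submoduleOf A :=
    Submodule.mapQ _ _ (Submodule.inclusion hBA) fun _ hx => hx
  let g : (A ⧸ C.submoduleOf A) →ₗ[R] A ⧸ B.submoduleOf A :=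
    Submodule.factor fun _ hx => hCB hx
  have ker_f : LinearMap.ker f = ⊥ :=
    (Submodule.ker_mapQ ..).trans (Submodule.mkQ_map_self _)
  have exact_fg : Function.Exact f g := LinearMap.exact_iff.2 <|
    (Submodule.ker_mapQ ..).trans <| .symm <| (Submodule.range_mapQ ..).trans <|
      congrArg _ (Submodule.range_inclusion B A hBA)
  rw [add_comm]
  exact (Module.length_eq_add_of_exact f g (LinearMap.ker_eq_bot.1 ker_f)
    (Submodule.factor_surjective _) exact_fg).symm

theorem relLength_map {f : M →ₗ[R] N} (hf : Function.Injective f) (A B : Submodule R M) :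
    relLength (A.map f) (B.map f) = relLength A B := by
  let e := Submodule.equivMapOfInjective f hf A
  refine (Submodule.Quotient.equiv _ _ e ?_).length_eq.symm
  ext z
  obtain ⟨a, rfl⟩ := e.surjective z
  have mem_iff : f a ∈ B.map f ↔ (a : M) ∈ B := hf.mem_set_image
  exact (Submodule.mem_map_equiv _).trans (by
    rw [e.symm_apply_apply]
    exact mem_iff.symm)

theorem relLength_top (B : Submodule R M) : relLength ⊤ B = Module.length R (M ⧸ B) :=
  (Submodule.Quotient.equiv _ _ Submodule.topEquiv
    (Submodule.map_comap_eq_of_surjective Submodule.topEquiv.surjective B)).length_eq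

theorem len_map {f : M →ₗ[R] N} (hf : Function.Injective f) (A B : Submodule R M) :
    len (A.map f) (B.map f) = len A B :=
  congrArg ENat.toNat (relLength_map hf A B)

theorem len_self (A : Submodule R M) : len A A = 0 :=
  congrArg ENat.toNat (relLength_eq_zero_iff.2 le_rfl)

variable {A B : Submodule R M}

theorem sup_span_singleton_eq_of_covBy (h : B ⋖ A) {y : M} (hyA : y ∈ A) (hyB : y ∉ B) :
    B ⊔ Submodule.span R {y} = A := by
  refine (h.eq_or_eq le_sup_left (sup_le h.le
    ((Submodule.span_singleton_le_iff_mem _ _).2 hyA))).resolve_left fun he => hyB ?_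
  exact (Submodule.span_singleton_le_iff_mem _ _).1 (sup_eq_left.1 he)

variable [IsLocalRing R]

theorem smul_mem_of_covBy (h : B ⋖ A) {r : R} (hr : r ∈ maximalIdeal R) {x : M} (hx : x ∈ A) :
    r • x ∈ B := by
  have : IsSimpleModule R (A ⧸ B.submoduleOf A) := (covBy_iff_quot_is_simple h.le).1 h
  have hr' := IsSemisimpleModule.jacobson_le_annihilator R (A ⧸ B.submoduleOf A)
    ((ringJacobson_eq_maximalIdeal R).ge hr)
  exact (Submodule.Quotient.mk_eq_zero (B.submoduleOf A)).1
    (Module.mem_annihilator.1 hr' (Submodule.Quotient.mk ⟨x, hx⟩))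

theorem wcovBy_sup_span_singleton {y : M} (hy : ∀ r ∈ maximalIdeal R, r • y ∈ B) :
    B ⩿ B ⊔ Submodule.span R {y} := by
  refine ⟨le_sup_left, fun C hBC hC => ?_⟩
  obtain ⟨z, hzC, hzB⟩ := SetLike.exists_of_lt hBC
  obtain ⟨b, hb, _, hs, rfl⟩ := Submodule.mem_sup.1 (hC.le hzC)
  obtain ⟨s, rfl⟩ := Submodule.mem_span_singleton.1 hs
  have hs : IsUnit s := by
    by_contra hs
    exact hzB (B.add_mem hb (hy s ((mem_maximalIdeal _).2 hs)))
  have hyC : y ∈ C := (C.smul_mem_iff_of_isUnit hs).1 ((C.add_mem_iff_right (hBC.le hb)).1 hzC)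
  exact hC.not_ge (sup_le hBC.le ((Submodule.span_singleton_le_iff_mem _ _).2 hyC))

end Length

section Colon

variable {R : Type*} [CommRing R] {K : Type*} [Field K] [Algebra R K]

theorem div_mul_eq (A B C : Submodule R K) : A / (B * C) = A / B / C :=
  eq_of_forall_le_iff fun D => by
    simp only [Submodule.le_div_iff_mul_le, mul_assoc, mul_comm B C]

theorem div_anti_right (A : Submodule R K) {B C : Submodule R K} (h : B ≤ C) : A / C ≤ A / B :=
  Submodule.le_div_iff_mul_le.2
    ((mul_le_mul_right h _).trans (Submodule.le_div_iff_mul_le.1 le_rfl))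

theorem div_one_eq (A : Submodule R K) : A / 1 = A :=
  eq_of_forall_le_iff fun D => by rw [Submodule.le_div_iff_mul_le, mul_one]

theorem div_sup_eq (A B C : Submodule R K) : A / (B ⊔ C) = A / B ⊓ (A / C) :=
  eq_of_forall_le_iff fun D => by
    rw [le_inf_iff, Submodule.le_div_iff_mul_le, Submodule.le_div_iff_mul_le,
      Submodule.le_div_iff_mul_le, Submodule.mul_sup, sup_le_iff]

theorem le_div_div (A B : Submodule R K) : B ≤ A / (A / B) := by
  rw [Submodule.le_div_iff_mul_le, mul_comm]
  exact Submodule.le_div_iff_mul_le.1 le_rfl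

theorem le_dual_iff {A B : Submodule R K} : A ≤ dual B ↔ A * B ≤ 1 :=
  Submodule.le_div_iff_mul_le

theorem dual_mul_le_one (A : Submodule R K) : dual A * A ≤ 1 := le_dual_iff.1 le_rfl

theorem span_singleton_mul_span_singleton_inv {x : K} (hx : x ≠ 0) :
    Submodule.span R {x} * Submodule.span R {x⁻¹} = 1 := by
  rw [Submodule.span_mul_span, Set.singleton_mul_singleton, mul_inv_cancel₀ hx,
    Submodule.one_eq_span]

theorem span_singleton_inv_mul_cancel_left {x : K} (hx : x ≠ 0) (A : Submodule R K) :
    Submodule.span R {x⁻¹} * (Submodule.span R {x} * A) = A := by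
  rw [← mul_assoc, mul_comm (Submodule.span R {x⁻¹}), span_singleton_mul_span_singleton_inv hx,
    one_mul]

theorem span_singleton_mul_inv_cancel_left {x : K} (hx : x ≠ 0) (A : Submodule R K) :
    Submodule.span R {x} * (Submodule.span R {x⁻¹} * A) = A := by
  rw [← mul_assoc, span_singleton_mul_span_singleton_inv hx, one_mul]

/-- Multiplication by a nonzero element of `K`, as an automorphism of the lattice of
`R`-submodules of `K`. -/
def spanSingletonMulIso {x : K} (hx : x ≠ 0) : Submodule R K ≃o Submodule R K where
  toFun A := Submodule.span R {x} * A
  invFun A := Submodule.span R {x⁻¹} * A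
  left_inv := span_singleton_inv_mul_cancel_left hx
  right_inv := span_singleton_mul_inv_cancel_left hx
  map_rel_iff' {A B} := by
    refine ⟨fun h => ?_, fun h => mul_le_mul_right h _⟩
    rw [← span_singleton_inv_mul_cancel_left hx A, ← span_singleton_inv_mul_cancel_left hx B]
    exact mul_le_mul_right h _

theorem span_singleton_mul_le_iff {x : K} (hx : x ≠ 0) {A B : Submodule R K} :
    Submodule.span R {x} * A ≤ B ↔ A ≤ Submodule.span R {x⁻¹} * B :=
  (spanSingletonMulIso hx).le_symm_apply.symm

theorem div_span_singleton_mul {x : K} (hx : x ≠ 0) (A B : Submodule R K) :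
    A / (Submodule.span R {x} * B) = Submodule.span R {x⁻¹} * (A / B) :=
  eq_of_forall_le_iff fun D => by
    rw [← span_singleton_mul_le_iff hx, Submodule.le_div_iff_mul_le, Submodule.le_div_iff_mul_le,
      mul_left_comm, mul_assoc]

theorem span_singleton_algebraMap_mul_le (x : R) (A : Submodule R K) :
    Submodule.span R {algebraMap R K x} * A ≤ A := by
  calc Submodule.span R {algebraMap R K x} * A ≤ 1 * A := mul_le_mul_left
        ((Submodule.span_singleton_le_iff_mem _ _).2 (Submodule.algebraMap_mem x)) A
    _ = A := one_mul A

theorem span_singleton_mul_eq_map (x : K) (A : Submodule R K) :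
    Submodule.span R {x} * A = A.map (LinearMap.mulLeft R x) := by
  ext y
  rw [Submodule.mem_span_singleton_mul, Submodule.mem_map]
  rfl

theorem len_span_singleton_mul {x : K} (hx : x ≠ 0) (A B : Submodule R K) :
    len (Submodule.span R {x} * A) (Submodule.span R {x} * B) = len A B := by
  rw [span_singleton_mul_eq_map, span_singleton_mul_eq_map]
  exact len_map (mul_right_injective₀ hx) A B

theorem IsCanonicalIdeal.div_self {ω : Submodule R K} (hω : IsCanonicalIdeal ω) : ω / ω = 1 := by
  have := hω.2.2 1 one_ne_zero (by rw [Submodule.one_eq_span]; exact Submodule.fg_span_singleton 1)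
  rwa [div_one_eq] at this

theorem IsCanonicalIdeal.div_mul {ω : Submodule R K} (hω : IsCanonicalIdeal ω)
    (A : Submodule R K) : ω / (ω * A) = dual A := by
  rw [div_mul_eq, hω.div_self, dual]

end Colon

section FractionalIdeal

variable {R : Type*} [CommRing R] {K : Type*} [Field K] [Algebra R K]

/-- A nonzero fractional ideal of `R`, encoded as a finitely generated submodule of `K`. -/
structure IsNonzeroFractional (I : Submodule R K) : Prop where
  ne_bot : I ≠ ⊥
  fg : I.FG

theorem IsCanonicalIdeal.isNonzeroFractional {ω : Submodule R K} (hω : IsCanonicalIdeal ω) :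
    IsNonzeroFractional ω :=
  ⟨hω.1, hω.2.1⟩

namespace IsNonzeroFractional

variable {A B C : Submodule R K}

protected theorem span_singleton {x : K} (hx : x ≠ 0) :
    IsNonzeroFractional (Submodule.span R {x}) :=
  ⟨mt Submodule.span_singleton_eq_bot.1 hx, Submodule.fg_span_singleton x⟩

protected theorem one : IsNonzeroFractional (1 : Submodule R K) :=
  Submodule.one_eq_span (R := R) (A := K) ▸ .span_singleton one_ne_zero

protected theorem mul (hA : IsNonzeroFractional A) (hB : IsNonzeroFractional B) :
    IsNonzeroFractional (A * B) :=
  ⟨mul_ne_zero hA.ne_bot hB.ne_bot, hA.fg.mul hB.fg⟩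

protected theorem pow (hA : IsNonzeroFractional A) (n : ℕ) : IsNonzeroFractional (A ^ n) :=
  ⟨pow_ne_zero n hA.ne_bot, hA.fg.pow n⟩

protected theorem sup (hA : IsNonzeroFractional A) (hB : IsNonzeroFractional B) :
    IsNonzeroFractional (A ⊔ B) :=
  ⟨ne_bot_of_le_ne_bot hA.ne_bot le_sup_left, hA.fg.sup hB.fg⟩

theorem exists_le_span_singleton [IsFractionRing R K] (hA : IsNonzeroFractional A) :
    ∃ y : K, y ≠ 0 ∧ A ≤ Submodule.span R {y} := by
  have := (algebraMap R K).domain_nontrivial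
  obtain ⟨a, ha, h⟩ := FractionalIdeal.isFractional_of_fg (S := nonZeroDivisors R) hA.fg
  have ha0 : algebraMap R K a ≠ 0 :=
    IsFractionRing.to_map_ne_zero_of_mem_nonZeroDivisors ha
  refine ⟨(algebraMap R K a)⁻¹, inv_ne_zero ha0, fun b hb => ?_⟩
  obtain ⟨r, hr⟩ := h b hb
  refine Submodule.mem_span_singleton.2 ⟨r, ?_⟩
  rw [Algebra.smul_def, hr, Algebra.smul_def]
  field_simp

variable [IsNoetherianRing R]

protected theorem of_le_of_le (hC : IsNonzeroFractional C) (hCB : C ≤ B) (hBA : B ≤ A)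
    (hA : IsNonzeroFractional A) : IsNonzeroFractional B :=
  have : Module.Finite R A := Module.Finite.iff_fg.2 hA.fg
  have := isNoetherian_of_isNoetherianRing_of_finite R A
  ⟨ne_bot_of_le_ne_bot hC.ne_bot hCB, isNoetherian_submodule.1 this B hBA⟩

protected theorem of_mem_of_le {x : K} (hx : x ∈ A) (hx0 : x ≠ 0) (hAB : A ≤ B)
    (hB : IsNonzeroFractional B) : IsNonzeroFractional A :=
  .of_le_of_le (.span_singleton hx0) ((Submodule.span_singleton_le_iff_mem _ _).2 hx) hAB hB

protected theorem div [IsFractionRing R K] (hA : IsNonzeroFractional A)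
    (hB : IsNonzeroFractional B) : IsNonzeroFractional (A / B) := by
  obtain ⟨y, hy0, hy⟩ := hB.exists_le_span_singleton
  obtain ⟨b, hb, hb0⟩ := Submodule.exists_mem_ne_zero_of_ne_bot hB.ne_bot
  have div_span (z : K) (hz : z ≠ 0) : A / Submodule.span R {z} = Submodule.span R {z⁻¹} * A := by
    rw [← mul_one (Submodule.span R {z}), div_span_singleton_mul hz, div_one_eq]
  have fractional_div_span (z : K) (hz : z ≠ 0) :
      IsNonzeroFractional (A / Submodule.span R {z}) :=
    div_span z hz ▸ (IsNonzeroFractional.span_singleton (inv_ne_zero hz)).mul hA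
  exact .of_le_of_le (fractional_div_span y hy0) (div_anti_right A hy)
    (div_anti_right A ((Submodule.span_singleton_le_iff_mem _ _).2 hb)) (fractional_div_span b hb0)

end IsNonzeroFractional

variable [IsNoetherianRing R] [IsFractionRing R K] {A B C : Submodule R K}

theorem IsCanonicalIdeal.covBy_div {ω : Submodule R K} (hω : IsCanonicalIdeal ω)
    (hA : IsNonzeroFractional A) (hB : IsNonzeroFractional B) (h : B ⋖ A) : ω / A ⋖ ω / B := by
  have hωF := hω.isNonzeroFractional
  have div_div := hω.2.2
  have div_strictAnti {C D : Submodule R K} (hC : IsNonzeroFractional C)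
      (hD : IsNonzeroFractional D) (hCD : C < D) : ω / D < ω / C :=
    (div_anti_right ω hCD.le).lt_of_ne fun he => hCD.ne <| by
      rw [← div_div C hC.ne_bot hC.fg, ← he, div_div D hD.ne_bot hD.fg]
  refine ⟨div_strictAnti hB hA h.lt, fun D hAD hDB => ?_⟩
  have hD : IsNonzeroFractional D := .of_le_of_le (hωF.div hA) hAD.le hDB.le (hωF.div hB)
  have hBD := div_strictAnti hD (hωF.div hB) hDB
  have hDA := div_strictAnti (hωF.div hA) hD hAD
  rw [div_div B hB.ne_bot hB.fg] at hBD
  rw [div_div A hA.ne_bot hA.fg] at hDA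
  exact h.2 hBD hDA

variable [IsDomain R] [Ring.KrullDimLE 1 R]

theorem relLength_span_singleton_ne_top {r : R} (hr : r ≠ 0) {y : K} (hy : y ≠ 0) :
    relLength (Submodule.span R {y}) (Submodule.span R {r • y}) ≠ ⊤ := by
  have hf : Function.Injective (LinearMap.toSpanSingleton R K y) :=
    LinearMap.ker_eq_bot.1 (LinearMap.ker_toSpanSingleton R hy)
  have span_y : Submodule.span R {y} =
      (⊤ : Submodule R R).map (LinearMap.toSpanSingleton R K y) := by
    rw [Submodule.map_top, LinearMap.range_toSpanSingleton]
  have span_ry : Submodule.span R {r • y} =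
      Submodule.map (LinearMap.toSpanSingleton R K y) (Ideal.span {r} : Ideal R) := by
    rw [← Ideal.submodule_span_eq, Submodule.map_span, Set.image_singleton,
      LinearMap.toSpanSingleton_apply]
  rw [span_y, span_ry, relLength_map hf, relLength_top]
  exact Module.length_ne_top_iff.2
    (isFiniteLength_quotient_span_singleton R (mem_nonZeroDivisors_of_ne_zero hr))

theorem relLength_ne_top (hA : IsNonzeroFractional A) (hB : IsNonzeroFractional B) (h : B ≤ A) :
    relLength A B ≠ ⊤ := by
  obtain ⟨y, hy0, hy⟩ := hA.exists_le_span_singleton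
  obtain ⟨b, hb, hb0⟩ := Submodule.exists_mem_ne_zero_of_ne_bot hB.ne_bot
  obtain ⟨r, rfl⟩ := Submodule.mem_span_singleton.1 (hy (h hb))
  have hr : r ≠ 0 := fun hr => hb0 (by rw [hr, zero_smul])
  have hle : Submodule.span R {r • y} ≤ B := (Submodule.span_singleton_le_iff_mem _ _).2 hb
  have := relLength_span_singleton_ne_top hr hy0
  rw [← relLength_add hy (hle.trans h), ← relLength_add h hle] at this
  intro htop
  simp [htop] at this

theorem coe_len (hA : IsNonzeroFractional A) (hB : IsNonzeroFractional B) (h : B ≤ A) :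
    (len A B : ℕ∞) = relLength A B :=
  ENat.natCast_toNat (relLength_ne_top hA hB h)

theorem len_add (hA : IsNonzeroFractional A) (hC : IsNonzeroFractional C) (hBA : B ≤ A)
    (hCB : C ≤ B) : len A C = len A B + len B C := by
  have hB : IsNonzeroFractional B := .of_le_of_le hC hCB hBA hA
  have : (len A C : ℕ∞) = len A B + len B C := by
    rw [coe_len hA hC (hCB.trans hBA), coe_len hA hB hBA, coe_len hB hC hCB, relLength_add hBA hCB]
  exact_mod_cast this

theorem eq_of_len_eq_zero (hA : IsNonzeroFractional A) (hB : IsNonzeroFractional B) (h : B ≤ A)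
    (h0 : len A B = 0) : B = A :=
  h.antisymm (relLength_eq_zero_iff.1 (by rw [← coe_len hA hB h, h0, Nat.cast_zero]))

theorem len_eq_one_iff (hA : IsNonzeroFractional A) (hB : IsNonzeroFractional B) (h : B ≤ A) :
    len A B = 1 ↔ B ⋖ A := by
  rw [← relLength_eq_one_iff h, ← coe_len hA hB h, Nat.cast_eq_one]

theorem exists_le_covBy (hA : IsNonzeroFractional A) (hC : IsNonzeroFractional C) (h : C < A) :
    ∃ B, C ≤ B ∧ B ⋖ A := by
  obtain ⟨B, ⟨hCB, hBA⟩, hmin⟩ :=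
    exists_minimalFor_of_wellFoundedLT (fun B => C ≤ B ∧ B < A) (len A) ⟨C, le_rfl, h⟩
  refine ⟨B, hCB, hBA, fun D hBD hDA => ?_⟩
  have hD : IsNonzeroFractional D := .of_le_of_le hC (hCB.trans hBD.le) hDA.le hA
  have hB : IsNonzeroFractional B := .of_le_of_le hC hCB hBA.le hA
  have hle : len A B ≤ len A D := hmin ⟨hCB.trans hBD.le, hDA⟩ (by
    rw [len_add hA hB hDA.le hBD.le]
    exact Nat.le_add_right _ _)
  have := len_add hA hB hDA.le hBD.le
  exact hBD.ne (eq_of_len_eq_zero hD hB hBD.le (by omega))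

theorem covBy_induction {p : Submodule R K → Prop} {J : Submodule R K}
    (hJ : IsNonzeroFractional J) (base : p J)
    (step : ∀ A B, J ≤ B → B ⋖ A → IsNonzeroFractional A → p B → p A)
    {I : Submodule R K} (hI : IsNonzeroFractional I) (hJI : J ≤ I) : p I := by
  induction hn : len I J using Nat.strong_induction_on generalizing I with | _ n ih
  subst hn
  rcases hJI.eq_or_lt with rfl | hlt
  · exact base
  obtain ⟨B, hJB, hBI⟩ := exists_le_covBy hI hJ hlt
  have hB : IsNonzeroFractional B := .of_le_of_le hJ hJB hBI.le hI
  refine step I B hJB hBI hI (ih _ ?_ hB hJB rfl)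
  rw [len_add hI hJ hBI.le hJB, (len_eq_one_iff hI hB hBI.le).2 hBI]
  omega

theorem len_span_singleton_mul_self {x : R} (hx : x ≠ 0) (hA : IsNonzeroFractional A) :
    len A (Submodule.span R {algebraMap R K x} * A) =
      len 1 (Submodule.span R {algebraMap R K x}) := by
  have hx0 : algebraMap R K x ≠ 0 := by simpa using hx
  set X := Submodule.span R {algebraMap R K x}
  have len_eq_of_le (A C : Submodule R K) (hA : IsNonzeroFractional A)
      (hC : IsNonzeroFractional C) (hAC : A ≤ C) : len A (X * A) = len C (X * C) := by
    have hXA := (IsNonzeroFractional.span_singleton (R := R) hx0).mul hA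
    have via_A : len C (X * A) = len C A + len A (X * A) :=
      len_add hC hXA hAC (span_singleton_algebraMap_mul_le x A)
    have via_XC : len C (X * A) = len C (X * C) + len (X * C) (X * A) :=
      len_add hC hXA (span_singleton_algebraMap_mul_le x C)
      (mul_le_mul_right hAC _)
    have : len (X * C) (X * A) = len C A := len_span_singleton_mul hx0 C A
    omega
  have hA1 := hA.sup .one
  rw [len_eq_of_le A (A ⊔ 1) hA hA1 le_sup_left,
    ← len_eq_of_le 1 (A ⊔ 1) .one hA1 le_sup_right, mul_one]

theorem IsCanonicalIdeal.len_div_div {ω : Submodule R K} (hω : IsCanonicalIdeal ω)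
    (hA : IsNonzeroFractional A) (hB : IsNonzeroFractional B) (h : B ≤ A) :
    len (ω / B) (ω / A) = len A B := by
  have hωF := hω.isNonzeroFractional
  refine covBy_induction (p := fun A => len (ω / B) (ω / A) = len A B) hB (by simp only [len_self])
    (fun A C hBC hCA hA ih => ?_) hA h
  have hC : IsNonzeroFractional C := .of_le_of_le hB hBC hCA.le hA
  have hcov := hω.covBy_div hA hC hCA
  rw [len_add (hωF.div hB) (hωF.div hA) (div_anti_right ω hBC) hcov.le, ih,
    len_add hA hB hCA.le hBC, (len_eq_one_iff hA hC hCA.le).2 hCA,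
    (len_eq_one_iff (hωF.div hC) (hωF.div hA) hcov.le).2 hcov, add_comm]

end FractionalIdeal

section Valuation

open IsDiscreteValuationRing

variable {R : Type*} [CommRing R] {K : Type*} [Field K] [Algebra R K]

theorem mem_Rbar {y : K} : y ∈ Rbar R K ↔ ∃ u : integralClosure R K, (u : K) = y :=
  ⟨fun h => ⟨⟨y, h⟩, rfl⟩, by rintro ⟨u, rfl⟩; exact u.2⟩

theorem one_le_Rbar : (1 : Submodule R K) ≤ Rbar R K :=
  Submodule.one_le.2 (one_mem (integralClosure R K))

theorem Rbar_mul_self : Rbar R K * Rbar R K = Rbar R K :=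
  (integralClosure R K).isIdempotentElem_toSubmodule

theorem isNonzeroFractional_Rbar [Module.Finite R (integralClosure R K)] :
    IsNonzeroFractional (Rbar R K) :=
  ⟨ne_bot_of_le_ne_bot one_ne_zero one_le_Rbar, Module.Finite.iff_fg.1 ‹_›⟩

theorem dual_one : dual (1 : Submodule R K) = 1 := div_one_eq 1

theorem dual_le_one {A : Submodule R K} (hA : 1 ≤ A) : dual A ≤ 1 :=
  (div_anti_right 1 hA).trans dual_one.le

theorem condIdeal_le_one : condIdeal R K ≤ 1 := dual_le_one one_le_Rbar

theorem condIdeal_mul_Rbar_le : condIdeal R K * Rbar R K ≤ condIdeal R K := by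
  rw [condIdeal, Submodule.le_div_iff_mul_le, mul_assoc, Rbar_mul_self]
  exact Submodule.le_div_iff_mul_le.1 le_rfl

theorem isNonzeroFractional_condIdeal [IsNoetherianRing R] [IsFractionRing R K]
    [Module.Finite R (integralClosure R K)] : IsNonzeroFractional (condIdeal R K) :=
  .div .one isNonzeroFractional_Rbar

variable [IsDiscreteValuationRing (integralClosure R K)]

variable (R K) in
/-- The elements of the integral closure of value at least `k`. -/
def valFil (k : ℕ) : Submodule R K where
  carrier := {y | ∃ u : integralClosure R K, (u : K) = y ∧
    (k : ℕ∞) ≤ addVal (integralClosure R K) u}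
  add_mem' := by
    rintro _ _ ⟨u, rfl, hu⟩ ⟨w, rfl, hw⟩
    exact ⟨u + w, rfl, (le_min hu hw).trans addVal_add⟩
  zero_mem' := ⟨0, rfl, by simp⟩
  smul_mem' := by
    rintro r _ ⟨u, rfl, hu⟩
    refine ⟨r • u, rfl, ?_⟩
    rw [Algebra.smul_def, addVal_mul]
    exact hu.trans le_add_self

theorem coe_mem_valFil {k : ℕ} {u : integralClosure R K} :
    (u : K) ∈ valFil R K k ↔ (k : ℕ∞) ≤ addVal (integralClosure R K) u := by
  constructor
  · rintro ⟨w, hw, h⟩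
    rwa [← Subtype.ext hw]
  · exact fun h => ⟨u, rfl, h⟩

theorem valFil_le_Rbar (k : ℕ) : valFil R K k ≤ Rbar R K := by
  rintro _ ⟨u, rfl, -⟩
  exact u.2

theorem valFil_zero : valFil R K 0 = Rbar R K := by
  refine (valFil_le_Rbar 0).antisymm fun y hy => ?_
  obtain ⟨u, rfl⟩ := mem_Rbar.1 hy
  exact coe_mem_valFil.2 (by simp)

theorem valFil_antitone : Antitone (valFil R K) := by
  rintro a b hab _ ⟨u, rfl, hu⟩
  exact ⟨u, rfl, le_trans (by exact_mod_cast hab) hu⟩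

theorem valFil_mul_valFil_le (a b : ℕ) : valFil R K a * valFil R K b ≤ valFil R K (a + b) := by
  rw [Submodule.mul_le]
  rintro _ ⟨u, rfl, hu⟩ _ ⟨w, rfl, hw⟩
  rw [← Subalgebra.coe_mul]
  refine coe_mem_valFil.2 ?_
  rw [addVal_mul, Nat.cast_add]
  exact add_le_add hu hw

theorem valFil_mul_Rbar_le (k : ℕ) : valFil R K k * Rbar R K ≤ valFil R K k := by
  rw [← valFil_zero]
  exact valFil_mul_valFil_le k 0

theorem valFil_one_pow_le (n : ℕ) : valFil R K 1 ^ n ≤ valFil R K n := by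
  induction n with
  | zero => rw [pow_zero, valFil_zero]; exact one_le_Rbar
  | succ n ih =>
    rw [pow_succ]
    exact (mul_le_mul_left ih _).trans (valFil_mul_valFil_le n 1)

theorem inf_valFil_succ_le (A : Submodule R K) (k : ℕ) :
    A ⊓ valFil R K (k + 1) ≤ A ⊓ valFil R K k :=
  inf_le_inf_left A (valFil_antitone k.le_succ)

theorem values_mono {A B : Submodule R K} (h : A ≤ B) : values A ⊆ values B := by
  rintro k ⟨u, hu, hk⟩
  exact ⟨u, h hu, hk⟩

theorem mem_values_valFil (k : ℕ) : k ∈ values (valFil R K k) := by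
  obtain ⟨p, hp⟩ := exists_irreducible (integralClosure R K)
  exact ⟨p ^ k, coe_mem_valFil.2 (hp.addVal_pow k).ge, hp.addVal_pow k⟩

theorem zero_mem_values_one : 0 ∈ values (1 : Submodule R K) :=
  ⟨1, Submodule.one_le.1 le_rfl, by simp⟩

theorem coe_ne_zero_of_addVal_eq {u : integralClosure R K} {k : ℕ}
    (hu : addVal (integralClosure R K) u = k) : (u : K) ≠ 0 := by
  rw [Ne, ZeroMemClass.coe_eq_zero, ← addVal_eq_top_iff, hu]
  exact ENat.natCast_ne_top k

theorem valFil_eq_span_singleton_mul {u : integralClosure R K} {k : ℕ}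
    (hu : addVal (integralClosure R K) u = k) :
    valFil R K k = Submodule.span R {(u : K)} * Rbar R K := by
  refine le_antisymm ?_ ?_
  · rintro _ ⟨w, rfl, hw⟩
    obtain ⟨z, rfl⟩ := addVal_le_iff_dvd.1 (hu.le.trans hw)
    exact Submodule.mem_span_singleton_mul.2 ⟨z, z.2, rfl⟩
  · rintro _ hw
    obtain ⟨z, hz, rfl⟩ := Submodule.mem_span_singleton_mul.1 hw
    obtain ⟨z, rfl⟩ := mem_Rbar.1 hz
    refine coe_mem_valFil (u := u * z).2 ?_
    rw [addVal_mul, hu]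
    exact le_self_add

theorem exists_mem_values_le_valFil {J : Submodule R K} (hJ0 : J ≠ ⊥) (hJ : J ≤ Rbar R K) :
    ∃ k ∈ values J, J ≤ valFil R K k := by
  obtain ⟨y, hyJ, hy0⟩ := Submodule.exists_mem_ne_zero_of_ne_bot hJ0
  obtain ⟨y, rfl⟩ := mem_Rbar.1 (hJ hyJ)
  obtain ⟨u, ⟨huJ, hu0⟩, hmin⟩ :=
    exists_minimalFor_of_wellFoundedLT (fun u : integralClosure R K => (u : K) ∈ J ∧ u ≠ 0)
      (addVal (integralClosure R K)) ⟨y, hyJ, by rintro rfl; exact hy0 rfl⟩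
  obtain ⟨k, hk⟩ := ENat.ne_top_iff_exists.1 (mt addVal_eq_top_iff.1 hu0)
  refine ⟨k, ⟨u, huJ, hk.symm⟩, fun w hw => ?_⟩
  obtain ⟨w, rfl⟩ := mem_Rbar.1 (hJ hw)
  rw [coe_mem_valFil, hk]
  rcases eq_or_ne w 0 with rfl | hw0
  · simp
  · exact (le_total _ _).elim id (hmin ⟨hw, hw0⟩)

theorem exists_eq_valFil {J : Submodule R K} (hJ0 : J ≠ ⊥) (hJ : J ≤ Rbar R K)
    (hmul : J * Rbar R K ≤ J) : ∃ k, J = valFil R K k := by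
  obtain ⟨k, ⟨u, huJ, hu⟩, hle⟩ := exists_mem_values_le_valFil hJ0 hJ
  refine ⟨k, hle.antisymm ?_⟩
  rw [valFil_eq_span_singleton_mul hu]
  exact (mul_le_mul_left ((Submodule.span_singleton_le_iff_mem _ _).2 huJ) _).trans hmul

theorem frac_idealR (i : ℕ) : frac K (idealR R K i) = 1 ⊓ valFil R K (sElem R K i) := by
  ext y
  rw [frac, IsLocalization.mem_coeSubmodule, Submodule.mem_inf, Submodule.mem_one]
  constructor
  · rintro ⟨r, hr, rfl⟩
    exact ⟨⟨r, rfl⟩, coe_mem_valFil (u := algebraMap R (integralClosure R K) r).2 hr⟩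
  · rintro ⟨⟨r, rfl⟩, h⟩
    exact ⟨r, coe_mem_valFil (u := algebraMap R (integralClosure R K) r).1 h, rfl⟩

theorem frac_idealR_zero : frac K (idealR R K 0) = 1 := by
  rw [frac_idealR, sElem, Nat.nth_zero_of_zero zero_mem_values_one, valFil_zero,
    inf_eq_left.2 one_le_Rbar]

section TypeSequence

variable [IsNoetherianRing R] [IsFractionRing R K] [Module.Finite R (integralClosure R K)]

variable (R K) in
theorem exists_condIdeal_eq_valFil : ∃ c, condIdeal R K = valFil R K c :=
  exists_eq_valFil isNonzeroFractional_condIdeal.ne_bot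
    (condIdeal_le_one.trans one_le_Rbar) condIdeal_mul_Rbar_le

theorem dual_condIdeal : dual (condIdeal R K) = Rbar R K := by
  obtain ⟨c, hc⟩ := exists_condIdeal_eq_valFil R K
  obtain ⟨u, -, hu⟩ := mem_values_valFil (R := R) (K := K) c
  have hu0 := coe_ne_zero_of_addVal_eq hu
  rw [valFil_eq_span_singleton_mul hu] at hc
  calc dual (condIdeal R K) = Submodule.span R {(u : K)⁻¹} * condIdeal R K := by
        rw [dual, hc, div_span_singleton_mul hu0, ← hc, condIdeal]
    _ = Rbar R K := by
        rw [hc, span_singleton_inv_mul_cancel_left hu0]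

theorem isNonzeroFractional_one_inf_valFil (k : ℕ) :
    IsNonzeroFractional ((1 : Submodule R K) ⊓ valFil R K k) := by
  obtain ⟨c, hc⟩ := exists_condIdeal_eq_valFil R K
  obtain ⟨u, hu, huv⟩ := mem_values_valFil (R := R) (K := K) (max c k)
  refine .of_mem_of_le (x := (u : K)) ⟨?_, valFil_antitone (le_max_right c k) hu⟩
    (coe_ne_zero_of_addVal_eq huv) inf_le_left .one
  exact condIdeal_le_one (hc ▸ valFil_antitone (le_max_left c k) hu)

variable (R K) in
theorem infinite_values_one : {k | k ∈ values (1 : Submodule R K)}.Infinite := by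
  obtain ⟨c, hc⟩ := exists_condIdeal_eq_valFil R K
  refine (Set.Ici_infinite c).mono fun k hk => values_mono condIdeal_le_one ?_
  rw [hc]
  exact values_mono (valFil_antitone hk) (mem_values_valFil k)

theorem sElem_strictMono : StrictMono (sElem R K) := Nat.nth_strictMono (infinite_values_one R K)

theorem dual_frac_idealR_mono : Monotone fun i => dual (frac K (idealR R K i)) := by
  intro i j hij
  refine div_anti_right 1 ?_
  rw [frac_idealR, frac_idealR]
  exact inf_le_inf_left _ (valFil_antitone (sElem_strictMono.monotone hij))

theorem sum_typeSeq_eq_len [IsDomain R] [Ring.KrullDimLE 1 R] (m : ℕ) :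
    ∑ i ∈ Finset.Icc 1 m, typeSeq R K i = len (dual (frac K (idealR R K m))) 1 := by
  have h0 : dual (frac K (idealR R K 0)) = 1 := by rw [frac_idealR_zero, dual_one]
  induction m with
  | zero => rw [h0, len_self, Finset.Icc_eq_empty one_pos.not_ge, Finset.sum_empty]
  | succ m ih =>
    rw [Finset.sum_Icc_succ_top (by omega), ih, typeSeq, Nat.add_sub_cancel, add_comm]
    refine (len_add (.div .one ?_) .one (dual_frac_idealR_mono m.le_succ) ?_).symm
    · exact frac_idealR (R := R) (K := K) (m + 1) ▸ isNonzeroFractional_one_inf_valFil _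
    · exact h0.ge.trans (dual_frac_idealR_mono m.zero_le)

end TypeSequence

section ResiduallyRational

theorem exists_sub_smul_mem_valFil_succ (hrat : ResiduallyRational R K) {k : ℕ}
    {u : integralClosure R K} (hu : addVal (integralClosure R K) u = k) {w : K}
    (hw : w ∈ valFil R K k) : ∃ r : R, w - r • (u : K) ∈ valFil R K (k + 1) := by
  obtain ⟨w, rfl, hkw⟩ := hw
  obtain ⟨z, rfl⟩ := addVal_le_iff_dvd.1 (hu.le.trans hkw)
  obtain ⟨r, hr⟩ := hrat (residue _ z)
  have one_le : 1 ≤ addVal (integralClosure R K) (z - algebraMap R _ r) := by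
    rw [Order.one_le_iff_pos, pos_iff_ne_zero, Ne, addVal_eq_zero_iff, ← mem_nonunits_iff,
      ← mem_maximalIdeal, ← residue_eq_zero_iff, map_sub, sub_eq_zero]
    exact hr.symm
  have factor : u * z - r • u = u * (z - algebraMap R _ r) := by
    rw [Algebra.smul_def]
    ring
  refine ⟨r, coe_mem_valFil (u := u * z - r • u).2 ?_⟩
  rw [factor, addVal_mul, hu, Nat.cast_add, Nat.cast_one]
  exact add_le_add_right one_le _

theorem inf_valFil_succ_of_notMem {A : Submodule R K} {k : ℕ} (hk : k ∉ values A) :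
    A ⊓ valFil R K (k + 1) = A ⊓ valFil R K k := by
  refine (inf_valFil_succ_le A k).antisymm ?_
  rintro _ ⟨hwA, w, rfl, hw⟩
  refine ⟨hwA, coe_mem_valFil.2 ?_⟩
  rw [Nat.cast_add, Nat.cast_one]
  exact Order.add_one_le_of_lt (hw.lt_of_ne fun h => hk ⟨w, hwA, h.symm⟩)

variable [IsDomain R] [IsLocalRing R] [IsFractionRing R K]

theorem one_le_addVal_algebraMap_iff {r : R} :
    1 ≤ addVal (integralClosure R K) (algebraMap R (integralClosure R K) r) ↔
      r ∈ maximalIdeal R := by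
  have : FaithfulSMul R K := (faithfulSMul_iff_algebraMap_injective R K).2
    (IsFractionRing.injective R K)
  rw [mem_maximalIdeal, mem_nonunits_iff, Order.one_le_iff_pos, pos_iff_ne_zero, Ne,
    addVal_eq_zero_iff, isUnit_map_iff]

theorem frac_maximalIdeal : frac K (maximalIdeal R) = 1 ⊓ valFil R K 1 := by
  have mem_iff (r : R) : algebraMap R K r ∈ valFil R K 1 ↔ r ∈ maximalIdeal R := by
    rw [← one_le_addVal_algebraMap_iff (K := K)]
    exact coe_mem_valFil (u := algebraMap R (integralClosure R K) r)
  ext y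
  rw [frac, IsLocalization.mem_coeSubmodule, Submodule.mem_inf, Submodule.mem_one]
  constructor
  · rintro ⟨r, hr, rfl⟩
    exact ⟨⟨r, rfl⟩, (mem_iff r).2 hr⟩
  · rintro ⟨⟨r, rfl⟩, h⟩
    exact ⟨r, (mem_iff r).1 h, rfl⟩

theorem smul_mem_valFil_succ {r : R} (hr : r ∈ maximalIdeal R) {k : ℕ} {y : K}
    (hy : y ∈ valFil R K k) : r • y ∈ valFil R K (k + 1) := by
  obtain ⟨u, rfl, hu⟩ := hy
  refine coe_mem_valFil (u := r • u).2 ?_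
  rw [Algebra.smul_def, addVal_mul, add_comm, Nat.cast_add, Nat.cast_one]
  exact add_le_add (one_le_addVal_algebraMap_iff.2 hr) hu

theorem inf_valFil_succ_covBy (hrat : ResiduallyRational R K) {A : Submodule R K} {k : ℕ}
    (hk : k ∈ values A) : A ⊓ valFil R K (k + 1) ⋖ A ⊓ valFil R K k := by
  obtain ⟨u, huA, hu⟩ := hk
  have hu_mem : (u : K) ∈ A ⊓ valFil R K k := ⟨huA, coe_mem_valFil.2 hu.ge⟩
  have hsup : A ⊓ valFil R K k = A ⊓ valFil R K (k + 1) ⊔ Submodule.span R {(u : K)} := by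
    refine le_antisymm ?_ (sup_le (inf_valFil_succ_le A k)
      ((Submodule.span_singleton_le_iff_mem _ _).2 hu_mem))
    rintro w ⟨hwA, hw⟩
    obtain ⟨r, hr⟩ := exists_sub_smul_mem_valFil_succ hrat hu hw
    rw [← sub_add_cancel w (r • (u : K))]
    exact Submodule.add_mem_sup ⟨A.sub_mem hwA (A.smul_mem r huA), hr⟩
      (Submodule.smul_mem _ r (Submodule.mem_span_singleton_self _))
  refine WCovBy.covBy_of_not_le ?_ fun hle => ?_
  · rw [hsup]
    exact wcovBy_sup_span_singleton fun r hr =>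
      ⟨A.smul_mem r huA, smul_mem_valFil_succ hr hu_mem.2⟩
  · have := coe_mem_valFil.1 (hle hu_mem).2
    rw [hu, Nat.cast_le] at this
    omega

open Classical in
theorem relLength_inf_valFil (hrat : ResiduallyRational R K) {A : Submodule R K}
    (hA : A ≤ Rbar R K) (k : ℕ) : relLength A (A ⊓ valFil R K k) = Nat.count (· ∈ values A) k := by
  induction k with
  | zero =>
    rw [valFil_zero, inf_eq_left.2 hA, relLength_eq_zero_iff.2 le_rfl, Nat.count_zero,
      Nat.cast_zero]
  | succ k ih =>
    rw [← relLength_add inf_le_left (inf_valFil_succ_le A k), ih, Nat.count_succ, Nat.cast_add]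
    split_ifs with hk
    · rw [(relLength_eq_one_iff (inf_valFil_succ_le A k)).2 (inf_valFil_succ_covBy hrat hk),
        Nat.cast_one]
    · rw [relLength_eq_zero_iff.2 (inf_valFil_succ_of_notMem hk).ge, Nat.cast_zero]

open Classical in
theorem len_eq_count_values (hrat : ResiduallyRational R K) {A : Submodule R K}
    (hA : A ≤ Rbar R K) {k : ℕ} (hk : valFil R K k ≤ A) :
    len A (valFil R K k) = Nat.count (· ∈ values A) k := by
  have := relLength_inf_valFil hrat hA k
  rw [inf_eq_right.2 hk] at this
  exact (congrArg ENat.toNat this).trans (ENat.toNat_natCast _)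

open Classical in
theorem numTS_eq_count (hrat : ResiduallyRational R K) {c : ℕ}
    (hc : condIdeal R K = valFil R K c) :
    numTS R K = Nat.count (· ∈ values (1 : Submodule R K)) c := by
  rw [numTS, hc, len_eq_count_values hrat one_le_Rbar (hc ▸ condIdeal_le_one)]

theorem sElem_numTS (hrat : ResiduallyRational R K) {c : ℕ}
    (hc : condIdeal R K = valFil R K c) : sElem R K (numTS R K) = c := by
  classical
  rw [numTS_eq_count hrat hc, sElem]
  exact Nat.nth_count (values_mono (hc ▸ condIdeal_le_one) (mem_values_valFil c))

variable [IsNoetherianRing R] [Module.Finite R (integralClosure R K)]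

theorem frac_idealR_one : frac K (idealR R K 1) = frac K (maximalIdeal R) := by
  have sElem_pos : 0 < sElem R K 1 := (Nat.zero_le _).trans_lt (sElem_strictMono one_pos)
  rw [frac_idealR, frac_maximalIdeal]
  refine le_antisymm (inf_le_inf_left _ (valFil_antitone sElem_pos)) (le_inf inf_le_left ?_)
  obtain ⟨k, hk, hle⟩ := exists_mem_values_le_valFil
    (isNonzeroFractional_one_inf_valFil (R := R) (K := K) 1).ne_bot
    (inf_le_left.trans one_le_Rbar)
  refine hle.trans (valFil_antitone (not_lt.1 fun hlt => ?_))
  have hk0 := Nat.le_nth_of_lt_nth_succ (k := 0) hlt (values_mono inf_le_left hk)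
  rw [Nat.nth_zero_of_zero zero_mem_values_one] at hk0
  obtain ⟨u, hu, huk⟩ := hk
  have := coe_mem_valFil.1 hu.2
  rw [huk, Nat.cast_le] at this
  omega

theorem typeSeq_one : typeSeq R K 1 = len (dual (frac K (maximalIdeal R))) 1 := by
  rw [typeSeq, frac_idealR_one, Nat.sub_self, frac_idealR_zero, dual_one]

open Classical in
theorem card_Gam (hrat : ResiduallyRational R K) {c : ℕ} (hc : condIdeal R K = valFil R K c)
    (I : Ideal R) (hI : dual (blowup K I) ≤ 1) :
    (Gam K I).card = Nat.count (· ∈ values (dual (blowup K I))) c := by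
  have hsub := values_mono hI
  have count_sElem (i : ℕ) : Nat.count (· ∈ values (1 : Submodule R K)) (sElem R K i) = i :=
    Nat.count_nth_of_infinite (infinite_values_one R K) i
  have sElem_count {k : ℕ} (hk : k ∈ values (1 : Submodule R K)) :
      sElem R K (Nat.count (· ∈ values (1 : Submodule R K)) k) = k := Nat.nth_count hk
  rw [Nat.count_eq_card_filter_range]
  refine Finset.card_nbij' (fun i => sElem R K (i - 1))
    (fun k => Nat.count (· ∈ values (1 : Submodule R K)) k + 1) ?_ ?_ ?_ ?_ <;>
  simp only [Gam, Finset.coe_filter, Finset.mem_Icc, Finset.mem_range, Set.MapsTo, Set.LeftInvOn,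
    Set.RightInvOn, Set.mem_ofPred_eq, Nat.add_sub_cancel]
  · rintro i ⟨hi, hiv⟩
    refine ⟨?_, hiv⟩
    rw [← sElem_numTS hrat hc]
    exact sElem_strictMono (by omega)
  · rintro k ⟨hkc, hkv⟩
    refine ⟨⟨by omega, ?_⟩, by rwa [sElem_count (hsub hkv)]⟩
    rw [numTS_eq_count hrat hc]
    exact Nat.count_strict_mono (hsub hkv) hkc
  · rintro i ⟨hi, -⟩
    rw [count_sElem]
    omega
  · rintro k ⟨-, hkv⟩
    exact sElem_count (hsub hkv)

variable [Ring.KrullDimLE 1 R]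

theorem sum_typeSeq (hrat : ResiduallyRational R K) :
    ∑ i ∈ Finset.Icc 1 (numTS R K), typeSeq R K i = delta R K := by
  obtain ⟨c, hc⟩ := exists_condIdeal_eq_valFil R K
  rw [sum_typeSeq_eq_len, frac_idealR, sElem_numTS hrat hc, ← hc, inf_eq_right.2 condIdeal_le_one,
    dual_condIdeal, delta]

theorem card_Gam_add_len (hrat : ResiduallyRational R K) (I : Ideal R)
    (hI : 1 ≤ blowup K I) (hI' : blowup K I ≤ Rbar R K) :
    (Gam K I).card + len 1 (dual (blowup K I)) = numTS R K := by
  obtain ⟨c, hc⟩ := exists_condIdeal_eq_valFil R K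
  have hD : condIdeal R K ≤ dual (blowup K I) := div_anti_right 1 hI'
  rw [card_Gam hrat hc I (dual_le_one hI),
    ← len_eq_count_values hrat ((dual_le_one hI).trans one_le_Rbar) (hc ▸ hD), ← hc, numTS,
    len_add .one isNonzeroFractional_condIdeal (dual_le_one hI) hD, add_comm]

theorem sum_typeSeq_sub_one (hrat : ResiduallyRational R K) (I : Ideal R)
    (hI : 1 ≤ blowup K I) (hI' : blowup K I ≤ Rbar R K) :
    ∑ i ∈ Finset.Icc 1 (numTS R K) \ Gam K I, ((typeSeq R K i : ℤ) - 1) =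
      dInv K I + len (dual (dual (blowup K I))) (blowup K I) + len (blowup K I) 1 -
        len 1 (dual (blowup K I)) := by
  classical
  have Gam_subset : Gam K I ⊆ Finset.Icc 1 (numTS R K) := Finset.filter_subset _ _
  have sum_sdiff := Finset.sum_sdiff Gam_subset (f := fun i => typeSeq R K i)
  have card_sdiff := Finset.card_sdiff_add_card_eq_card Gam_subset
  rw [Nat.card_Icc, Nat.add_sub_cancel] at card_sdiff
  have card_Gam := card_Gam_add_len hrat I hI hI'
  have dual_dual_le : dual (dual (blowup K I)) ≤ Rbar R K :=
    (div_anti_right 1 (div_anti_right 1 hI')).trans_eq dual_condIdeal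
  have delta_eq : delta R K = len (Rbar R K) (dual (dual (blowup K I))) +
      (len (dual (dual (blowup K I))) (blowup K I) + len (blowup K I) 1) := by
    rw [delta, len_add isNonzeroFractional_Rbar .one hI' hI,
      len_add isNonzeroFractional_Rbar
        (.of_le_of_le .one hI hI' isNonzeroFractional_Rbar) dual_dual_le (le_div_div 1 _),
      add_assoc]
  rw [sum_typeSeq hrat, delta_eq] at sum_sdiff
  zify at sum_sdiff card_sdiff card_Gam
  rw [Finset.sum_sub_distrib, Finset.sum_const, nsmul_one, dInv]
  linarith

end ResiduallyRational

end Valuation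

section Hilbert

variable {R : Type*} [CommRing R] {K : Type*} [Field K] [Algebra R K]

theorem algebraMap_mem_frac {I : Ideal R} {x : R} (hx : x ∈ I) : algebraMap R K x ∈ frac K I :=
  (IsLocalization.mem_coeSubmodule _ _).2 ⟨x, hx, rfl⟩

theorem frac_mul (I J : Ideal R) : frac K (I * J) = frac K I * frac K J :=
  IsLocalization.coeSubmodule_mul K I J

theorem frac_pow (I : Ideal R) (n : ℕ) : frac K (I ^ n) = frac K I ^ n := by
  induction n with
  | zero => rw [pow_zero, pow_zero, Ideal.one_eq_top, frac, IsLocalization.coeSubmodule_top]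
  | succ n ih => rw [pow_succ, pow_succ, ← ih, frac_mul]

theorem frac_span_singleton (x : R) :
    frac K (Ideal.span {x}) = Submodule.span R {algebraMap R K x} :=
  IsLocalization.coeSubmodule_span_singleton K x

theorem frac_le_one (I : Ideal R) : frac K I ≤ 1 := by
  rw [← IsLocalization.coeSubmodule_top K]
  exact IsLocalization.coeSubmodule_mono K le_top

theorem frac_injective [IsFractionRing R K] : Function.Injective (frac (R := R) K) :=
  IsFractionRing.coeSubmodule_injective R K

theorem isNonzeroFractional_frac [IsNoetherianRing R] [IsFractionRing R K] {I : Ideal R}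
    (hI : I ≠ ⊥) : IsNonzeroFractional (frac K I) := by
  refine ⟨fun h => hI (frac_injective (K := K) (h.trans ?_)),
    Submodule.FG.map _ (IsNoetherian.noetherian I)⟩
  exact (Submodule.map_bot _).symm

theorem hilbertFun_eq_len [IsFractionRing R K] (I : Ideal R) (n : ℕ) :
    hilbertFun I n = len (frac K I ^ n) (frac K I ^ (n + 1)) := by
  rw [← frac_pow, ← frac_pow]
  exact (len_map (IsFractionRing.injective R K : Function.Injective (Algebra.linearMap R K))
    _ _).symm

theorem coeff_succ_one_sub_X_mul {S : Type*} [CommRing S] (f : PowerSeries S) (n : ℕ) :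
    PowerSeries.coeff (n + 1) ((1 - PowerSeries.X) * f) =
      PowerSeries.coeff (n + 1) f - PowerSeries.coeff n f := by
  rw [sub_mul, one_mul, map_sub, PowerSeries.coeff_succ_X_mul]

theorem sum_range_coeff_one_sub_X_mul {S : Type*} [CommRing S] (f : PowerSeries S) (n : ℕ) :
    ∑ i ∈ Finset.range (n + 1), PowerSeries.coeff i ((1 - PowerSeries.X) * f) =
      PowerSeries.coeff n f := by
  induction n with
  | zero =>
    rw [zero_add, Finset.sum_range_one, sub_mul, one_mul, map_sub, PowerSeries.coeff_zero_X_mul,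
      sub_zero]
  | succ n ih => rw [Finset.sum_range_succ, ih, coeff_succ_one_sub_X_mul, add_sub_cancel]

theorem mult_eq_of_hilbertFun_eq (I : Ideal R) {e k : ℕ} (h : ∀ n ≥ k, hilbertFun I n = e) :
    mult I = e := by
  have coeff_hilbertSeries (n : ℕ) :
      PowerSeries.coeff n (hilbertSeries I) = (hilbertFun I n : ℤ) := PowerSeries.coeff_mk _ _
  have exists_poly : ∃ p : Polynomial ℤ,
      (p : PowerSeries ℤ) = (1 - (PowerSeries.X : PowerSeries ℤ)) * hilbertSeries I := by
    refine ⟨PowerSeries.trunc (k + 1) ((1 - PowerSeries.X) * hilbertSeries I), ?_⟩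
    ext n
    rw [Polynomial.coeff_coe, PowerSeries.coeff_trunc]
    split_ifs with hn
    · rfl
    · obtain ⟨m, rfl⟩ : ∃ m, n = m + 1 := ⟨n - 1, by omega⟩
      rw [coeff_succ_one_sub_X_mul, coeff_hilbertSeries, coeff_hilbertSeries, h (m + 1) (by omega),
        h m (by omega), sub_self]
  have coe_hPoly : (hPoly I : PowerSeries ℤ) = (1 - PowerSeries.X) * hilbertSeries I := by
    rw [hPoly, dif_pos exists_poly]
    exact exists_poly.choose_spec
  rw [mult, Polynomial.eval_eq_sum_range' (n := max k (hPoly I).natDegree + 1) (by omega)]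
  simp only [one_pow, mul_one, ← Polynomial.coeff_coe, coe_hPoly]
  rw [sum_range_coeff_one_sub_X_mul, coeff_hilbertSeries, h _ (le_max_left _ _)]

theorem embDim_eq_hilbertFun [IsNoetherianRing R] [IsLocalRing R] :
    embDim R = hilbertFun (maximalIdeal R) 1 := by
  have smul_top_eq : (maximalIdeal R • ⊤ : Submodule R (maximalIdeal R)) =
      (maximalIdeal R ^ 2).submoduleOf (maximalIdeal R) := by
    refine Submodule.map_injective_of_injective (maximalIdeal R).injective_subtype ?_
    rw [Submodule.map_smul'', Submodule.map_top, Submodule.range_subtype, smul_eq_mul, ← sq,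
      Submodule.submoduleOf, Submodule.map_comap_subtype]
    exact (inf_eq_right.2 (Ideal.pow_le_self two_ne_zero)).symm
  have length_eq : Module.length R (CotangentSpace R) = embDim R := by
    rw [Module.length_eq_of_surjective (R := ResidueField R) residue_surjective,
      Module.length_eq_finrank, embDim]
  calc embDim R = (Module.length R (CotangentSpace R)).toNat := by rw [length_eq]; rfl
    _ = hilbertFun (maximalIdeal R) 1 := by rw [hilbertFun, pow_one, len, ← smul_top_eq]; rfl

end Hilbert

theorem pow_eq_of_pow_succ_eq {M : Type*} [Monoid M] {a : M} {k : ℕ} (hk : a ^ (k + 1) = a ^ k)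
    {n : ℕ} (hn : k ≤ n) : a ^ n = a ^ k := by
  induction n, hn using Nat.le_induction with
  | base => rfl
  | succ n _ ih => rw [pow_succ, ih, ← pow_succ, hk]

section Reduction

variable {R : Type*} [CommRing R] (K : Type*) [Field K] [Algebra R K]

/-- The fractional ideal `x⁻¹ I`. Its powers increase to the blowing-up `Λ(I)` when `x` generates
a reduction of `I`. -/
def scaled (I : Ideal R) (x : R) : Submodule R K :=
  Submodule.span R {(algebraMap R K x)⁻¹} * frac K I

/-- The element `x` of `I` generates a principal reduction of `I`: every element of `I` is a
multiple of `x` in the integral closure, expressed as `x⁻¹ I ⊆ R̄`. -/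
structure IsPrincipalReduction (I : Ideal R) (x : R) : Prop where
  mem : x ∈ I
  algebraMap_ne_zero : algebraMap R K x ≠ 0
  scaled_le : scaled K I x ≤ Rbar R K

variable {K} {I : Ideal R}

theorem exists_isPrincipalReduction [IsNoetherianRing R] [IsFractionRing R K]
    [IsDiscreteValuationRing (integralClosure R K)] (hI : I ≠ ⊥) :
    ∃ x, IsPrincipalReduction K I x := by
  obtain ⟨k, ⟨u, huI, hu⟩, hle⟩ := exists_mem_values_le_valFil
    (isNonzeroFractional_frac (K := K) hI).ne_bot ((frac_le_one I).trans one_le_Rbar)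
  obtain ⟨x, hx, hxu⟩ := (IsLocalization.mem_coeSubmodule _ _).1 huI
  have hx0 : algebraMap R K x ≠ 0 := hxu ▸ coe_ne_zero_of_addVal_eq hu
  refine ⟨x, hx, hx0, ?_⟩
  rw [scaled, span_singleton_mul_le_iff (inv_ne_zero hx0), inv_inv, hxu,
    ← valFil_eq_span_singleton_mul hu]
  exact hle

namespace IsPrincipalReduction

variable {x : R} (hx : IsPrincipalReduction K I x)
include hx

theorem ne_zero : x ≠ 0 := by
  rintro rfl
  exact hx.algebraMap_ne_zero (map_zero _)

theorem ideal_ne_bot : I ≠ ⊥ := by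
  rintro rfl
  exact hx.ne_zero ((Ideal.mem_bot).1 hx.mem)

theorem span_mul_scaled : Submodule.span R {algebraMap R K x} * scaled K I x = frac K I := by
  rw [scaled, span_singleton_mul_inv_cancel_left hx.algebraMap_ne_zero]

theorem one_le : 1 ≤ scaled K I x :=
  Submodule.one_le.2 (Submodule.mem_span_singleton_mul.2
    ⟨algebraMap R K x, algebraMap_mem_frac hx.mem, inv_mul_cancel₀ hx.algebraMap_ne_zero⟩)

theorem not_Rbar_le_one (hI : scaled K I x ≠ 1) : ¬ Rbar R K ≤ 1 := fun h =>
  hI ((hx.scaled_le.trans h).antisymm hx.one_le)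

theorem dual_scaled : dual (scaled K I x) =
    Submodule.span R {algebraMap R K x} * dual (frac K I) := by
  rw [dual, scaled, div_span_singleton_mul (inv_ne_zero hx.algebraMap_ne_zero), inv_inv, dual]

theorem pow_mono : Monotone fun n => scaled K I x ^ n := pow_right_mono₀ hx.one_le

theorem one_le_pow (n : ℕ) : 1 ≤ scaled K I x ^ n := one_le_pow₀ hx.one_le

theorem pow_le_Rbar (n : ℕ) : scaled K I x ^ n ≤ Rbar R K := by
  induction n with
  | zero => exact (pow_zero (scaled K I x)).le.trans one_le_Rbar
  | succ n ih =>
    rw [pow_succ, ← Rbar_mul_self]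
    exact mul_le_mul' ih hx.scaled_le

theorem span_pow_mul_pow (n : ℕ) :
    Submodule.span R {algebraMap R K x ^ n} * scaled K I x ^ n = frac K I ^ n := by
  rw [← hx.span_mul_scaled, mul_pow, Submodule.span_pow, Set.singleton_pow]

theorem span_pow_succ_mul_pow (n : ℕ) :
    Submodule.span R {algebraMap R K x ^ (n + 1)} * scaled K I x ^ n =
      Submodule.span R {algebraMap R K x} * frac K I ^ n := by
  rw [← hx.span_pow_mul_pow, ← mul_assoc, Submodule.span_mul_span, Set.singleton_mul_singleton,
    ← pow_succ']

theorem exists_pow_succ_eq [IsNoetherianRing R] [Module.Finite R (integralClosure R K)] :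
    ∃ k, scaled K I x ^ (k + 1) = scaled K I x ^ k := by
  have : IsNoetherian R (Rbar R K) := inferInstanceAs (IsNoetherian R (integralClosure R K))
  obtain ⟨k, hk⟩ := monotone_stabilizes_iff_noetherian.2 this
    ⟨fun n => (scaled K I x ^ n).submoduleOf (Rbar R K),
      fun a b hab => Submodule.comap_mono (hx.pow_mono hab)⟩
  refine ⟨k, le_antisymm (fun y hy => ?_) (hx.pow_mono k.le_succ)⟩
  have := (SetLike.ext_iff.1 (hk (k + 1) k.le_succ) ⟨y, hx.pow_le_Rbar _ hy⟩).2 hy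
  exact this

theorem blowup_eq {k : ℕ} (hk : scaled K I x ^ (k + 1) = scaled K I x ^ k) :
    blowup K I = scaled K I x ^ k := by
  have div_pow (n : ℕ) : frac K I ^ n / frac K I ^ n = scaled K I x ^ n / scaled K I x ^ n := by
    rw [← hx.span_pow_mul_pow]
    refine eq_of_forall_le_iff fun D => ?_
    have hxn := pow_ne_zero n hx.algebraMap_ne_zero
    rw [Submodule.le_div_iff_mul_le, Submodule.le_div_iff_mul_le, mul_left_comm,
      span_singleton_mul_le_iff hxn, span_singleton_inv_mul_cancel_left hxn]
  simp only [blowup, div_pow]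
  refine le_antisymm (iSup_le fun n => ?_) (le_iSup_of_le k ?_)
  · calc scaled K I x ^ n / scaled K I x ^ n ≤ scaled K I x ^ n / 1 :=
          div_anti_right _ (hx.one_le_pow n)
      _ = scaled K I x ^ n := div_one_eq _
      _ ≤ scaled K I x ^ max n k := hx.pow_mono (le_max_left n k)
      _ = scaled K I x ^ k := pow_eq_of_pow_succ_eq hk (le_max_right n k)
  · rw [Submodule.le_div_iff_mul_le, ← pow_add]
    exact (pow_eq_of_pow_succ_eq hk (Nat.le_add_left k k)).le

variable [IsFractionRing R K]

theorem pow_succ_eq_iff (n : ℕ) :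
    scaled K I x ^ (n + 1) = scaled K I x ^ n ↔ I ^ (n + 1) = Ideal.span {x} * I ^ n := by
  rw [← (frac_injective (K := K)).eq_iff, frac_mul, frac_span_singleton, frac_pow, frac_pow,
    ← hx.span_pow_succ_mul_pow, ← hx.span_pow_mul_pow]
  exact (spanSingletonMulIso (pow_ne_zero (n + 1) hx.algebraMap_ne_zero)).injective.eq_iff.symm

theorem isNonzeroFractional_scaled [IsNoetherianRing R] : IsNonzeroFractional (scaled K I x) :=
  .mul (.span_singleton (inv_ne_zero hx.algebraMap_ne_zero))
    (isNonzeroFractional_frac hx.ideal_ne_bot)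

variable [IsDomain R] [IsNoetherianRing R]

section Finite

variable [Module.Finite R (integralClosure R K)]

/- If `I ^ (n + 1) = y I ^ n` for all `n ≥ k`, then `I ^ j = y ^ (j - k) I ^ k`, and for a `j` with
`I ^ (j + 1) = x I ^ j` cancelling `y ^ (j - k)` leaves `x I ^ k = y I ^ k = I ^ (k + 1)`. -/
theorem pow_succ_eq_of_forall_ge {y : R} {k : ℕ}
    (hy : ∀ n ≥ k, I ^ (n + 1) = Ideal.span {y} * I ^ n) :
    I ^ (k + 1) = Ideal.span {x} * I ^ k := by
  have hy0 : y ≠ 0 := by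
    rintro rfl
    have := hy k le_rfl
    rw [Ideal.span_singleton_eq_bot.2 rfl, Ideal.bot_mul] at this
    exact pow_ne_zero (k + 1) hx.ideal_ne_bot this
  have pow_add_eq (m : ℕ) : I ^ (k + m) = Ideal.span {y ^ m} * I ^ k := by
    induction m with
    | zero => rw [pow_zero, Ideal.span_singleton_one, Ideal.top_mul, add_zero]
    | succ m ih =>
      rw [← add_assoc, hy _ (Nat.le_add_right k m), ih, ← mul_assoc,
        Ideal.span_singleton_mul_span_singleton, ← pow_succ']
  obtain ⟨j, hj⟩ := hx.exists_pow_succ_eq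
  have stable : I ^ (k + j + 1) = Ideal.span {x} * I ^ (k + j) := by
    refine (hx.pow_succ_eq_iff _).1 ?_
    rw [pow_eq_of_pow_succ_eq hj (Nat.le_add_left j k), pow_eq_of_pow_succ_eq hj (by omega)]
  rw [← Ideal.span_singleton_mul_right_inj (pow_ne_zero j hy0), mul_left_comm, ← pow_add_eq j,
    ← stable, add_assoc, pow_add_eq (j + 1), pow_succ y, ← Ideal.span_singleton_mul_span_singleton,
    mul_assoc, ← hy k le_rfl]

theorem reductionExponent_eq :
    reductionExponent I = sInf {k | scaled K I x ^ (k + 1) = scaled K I x ^ k} := by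
  rw [reductionExponent]
  congr 1
  ext k
  constructor
  · rintro ⟨y, -, hy⟩
    exact (hx.pow_succ_eq_iff k).2 (hx.pow_succ_eq_of_forall_ge hy)
  · refine fun hk => ⟨x, hx.mem, fun n hn => (hx.pow_succ_eq_iff n).1 ?_⟩
    rw [pow_eq_of_pow_succ_eq hk hn, pow_eq_of_pow_succ_eq hk (hn.trans n.le_succ)]

theorem pow_reductionExponent_succ :
    scaled K I x ^ (reductionExponent I + 1) = scaled K I x ^ reductionExponent I := by
  rw [hx.reductionExponent_eq]
  exact Nat.sInf_mem hx.exists_pow_succ_eq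

theorem pow_succ_ne {n : ℕ} (hn : n < reductionExponent I) :
    scaled K I x ^ (n + 1) ≠ scaled K I x ^ n := by
  rw [hx.reductionExponent_eq] at hn
  exact Nat.notMem_of_lt_sInf hn

theorem blowup_eq_pow_reductionExponent : blowup K I = scaled K I x ^ reductionExponent I :=
  hx.blowup_eq hx.pow_reductionExponent_succ

end Finite

variable [Ring.KrullDimLE 1 R]

/- Both summands are lengths between consecutive terms of the chain
`x I ^ n ⊆ I ^ (n + 1) ⊆ I ^ n`. -/
theorem hilbertFun_add_len (n : ℕ) :
    hilbertFun I n + len (scaled K I x ^ (n + 1)) (scaled K I x ^ n) =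
      len 1 (Submodule.span R {algebraMap R K x}) := by
  have hIn := (isNonzeroFractional_frac (K := K) hx.ideal_ne_bot).pow n
  rw [hilbertFun_eq_len (K := K), ← len_span_singleton_mul_self hx.ne_zero hIn,
    ← len_span_singleton_mul (pow_ne_zero (n + 1) hx.algebraMap_ne_zero) (scaled K I x ^ (n + 1)),
    hx.span_pow_mul_pow, hx.span_pow_succ_mul_pow]
  refine (len_add hIn (.mul (.span_singleton hx.algebraMap_ne_zero) hIn) ?_ ?_).symm
  · rw [pow_succ]
    exact (mul_le_mul_right (frac_le_one I) _).trans (mul_one _).le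
  · rw [pow_succ']
    exact mul_le_mul_left
      ((Submodule.span_singleton_le_iff_mem _ _).2 (algebraMap_mem_frac hx.mem)) _

theorem mult_eq [Module.Finite R (integralClosure R K)] :
    mult I = len 1 (Submodule.span R {algebraMap R K x}) := by
  obtain ⟨k, hk⟩ := hx.exists_pow_succ_eq
  refine mult_eq_of_hilbertFun_eq I (k := k) fun n hn => ?_
  rw [← hx.hilbertFun_add_len n, pow_eq_of_pow_succ_eq hk hn,
    pow_eq_of_pow_succ_eq hk (hn.trans n.le_succ), len_self, add_zero]

end IsPrincipalReduction

end Reduction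

section Gorenstein

variable {R : Type*} [CommRing R] {K : Type*} [Field K] [Algebra R K]

theorem one_le_dual_frac (I : Ideal R) : 1 ≤ dual (frac K I) := by
  rw [le_dual_iff, one_mul]
  exact frac_le_one I

theorem dual_dual_span_singleton {y : K} (hy : y ≠ 0) :
    dual (dual (Submodule.span R {y})) = Submodule.span R {y} := by
  have dual_span {z : K} (hz : z ≠ 0) :
      dual (Submodule.span R {z}) = Submodule.span R {z⁻¹} := by
    rw [dual, ← mul_one (Submodule.span R {z}), div_span_singleton_mul hz, div_one_eq, mul_one]
  rw [dual_span hy, dual_span (inv_ne_zero hy), inv_inv]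

variable [IsLocalRing R]

/- Write `I = J + yR`. Multiplication by `y` maps `J*` into `𝔪*` and turns the inclusion
`I* ⊆ J*` into `yJ* ∩ R ⊆ yJ*`, so the claim follows from modularity. -/
theorem wcovBy_dual_of_covBy (h1 : 1 ⋖ dual (frac K (maximalIdeal R))) {I J : Submodule R K}
    (h : J ⋖ I) : dual I ⩿ dual J := by
  obtain ⟨y, hyI, hyJ⟩ := SetLike.exists_of_lt h.lt
  have hy0 : y ≠ 0 := fun h0 => hyJ (h0 ▸ J.zero_mem)
  have dual_eq : dual I = dual J ⊓ Submodule.span R {y⁻¹} := by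
    rw [← sup_span_singleton_eq_of_covBy h hyI hyJ, dual, div_sup_eq,
      ← mul_one (Submodule.span R {y}), div_span_singleton_mul hy0, div_one_eq, mul_one, dual]
  have mul_dual_le : Submodule.span R {y} * dual J ≤ dual (frac K (maximalIdeal R)) := by
    rw [le_dual_iff, mul_right_comm, mul_comm]
    refine (mul_le_mul_right ?_ (dual J)).trans (dual_mul_le_one J)
    rintro _ hz
    obtain ⟨_, hw, rfl⟩ := Submodule.mem_span_singleton_mul.1 hz
    obtain ⟨r, hr, rfl⟩ := (IsLocalization.mem_coeSubmodule _ _).1 hw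
    rw [mul_comm, ← Algebra.smul_def]
    exact smul_mem_of_covBy h hr hyI
  rw [← apply_wcovBy_apply_iff (spanSingletonMulIso hy0), dual_eq, map_inf]
  change _ ⊓ Submodule.span R {y} * Submodule.span R {y⁻¹} ⩿ Submodule.span R {y} * dual J
  rw [span_singleton_mul_span_singleton_inv hy0]
  rcases h1.eq_or_eq le_sup_left (sup_le h1.le mul_dual_le) with he | he
  · exact (inf_eq_left.2 (sup_eq_left.1 he)).wcovBy
  · rw [← he] at h1
    rw [inf_comm]
    exact (inf_covBy_of_covBy_sup_left h1).wcovBy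

theorem frac_maximalIdeal_covBy_one [IsFractionRing R K] :
    frac K (maximalIdeal R) ⋖ (1 : Submodule R K) := by
  have injective : Function.Injective (Algebra.linearMap R K) := IsFractionRing.injective R K
  rw [← relLength_eq_one_iff (frac_le_one _), ← IsLocalization.coeSubmodule_top K, frac,
    IsLocalization.coeSubmodule, IsLocalization.coeSubmodule, relLength_map injective,
    relLength_eq_one_iff le_top]
  exact covBy_top_iff.2 (maximalIdeal.isMaximal R).out

variable [IsDomain R] [IsNoetherianRing R] [Ring.KrullDimLE 1 R] [IsFractionRing R K]

/- Covers of fractional ideals `J ⋖ I` dualize to weak covers, so reflexivity climbs from a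
principal submodule `yR` of `I` to `I` itself. -/
theorem isGorenstein_of_one_covBy_dual (h1 : 1 ⋖ dual (frac K (maximalIdeal R))) :
    IsGorenstein R K := by
  refine ⟨one_ne_zero, IsNonzeroFractional.one.fg, fun I hI hIfg => ?_⟩
  obtain ⟨y, hyI, hy0⟩ := Submodule.exists_mem_ne_zero_of_ne_bot hI
  refine covBy_induction (p := fun A => dual (dual A) = A) (.span_singleton hy0)
    (dual_dual_span_singleton hy0) (fun A B _ hBA _ hB => ?_) ⟨hI, hIfg⟩
    ((Submodule.span_singleton_le_iff_mem _ _).2 hyI)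
  have le_bidual : A ≤ dual (dual A) := le_div_div 1 A
  rcases (wcovBy_dual_of_covBy h1 hBA).eq_or_covBy with he | hcov
  · rw [he, hB] at le_bidual
    exact (hBA.lt.not_ge le_bidual).elim
  · have := wcovBy_dual_of_covBy h1 hcov
    rw [hB] at this
    exact (this.eq_or_eq hBA.le le_bidual).resolve_left hBA.lt.ne' |>.symm

theorem isGorenstein_iff_len_dual (hm : maximalIdeal R ≠ ⊥) :
    IsGorenstein R K ↔ len (dual (frac K (maximalIdeal R))) 1 = 1 := by
  have hM := isNonzeroFractional_frac (K := K) hm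
  rw [len_eq_one_iff (A := dual _) (.div .one hM) .one (one_le_dual_frac _)]
  refine ⟨fun h => ?_, isGorenstein_of_one_covBy_dual⟩
  have := IsCanonicalIdeal.covBy_div h .one hM frac_maximalIdeal_covBy_one
  rwa [div_one_eq] at this

end Gorenstein

section Canonical

namespace IsCanonicalIdeal

variable {R : Type*} [CommRing R] {K : Type*} [Field K] [Algebra R K]
  {ω : Submodule R K} (hω : IsCanonicalIdeal ω)
include hω

theorem div_eq_dual {A : Submodule R K} (hωA : ω * A = A) : ω / A = dual A := by
  rw [← hω.div_mul, hωA]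

theorem div_Rbar (h1 : 1 ≤ ω) (hω' : ω ≤ Rbar R K) : ω / Rbar R K = condIdeal R K :=
  hω.div_eq_dual
    (le_antisymm ((mul_le_mul_left hω' _).trans_eq Rbar_mul_self) (le_mul_of_one_le_left' h1))

variable [IsDomain R] [IsNoetherianRing R] [Ring.KrullDimLE 1 R] [IsFractionRing R K]

theorem len_mul_frac {I : Ideal R} (hI : I ≠ ⊥) :
    len ω (ω * frac K I) = len (dual (frac K I)) 1 := by
  have hM := isNonzeroFractional_frac (K := K) hI
  rw [← hω.len_div_div hω.isNonzeroFractional (hω.isNonzeroFractional.mul hM)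
    (mul_le_of_le_one_right' (frac_le_one _)), hω.div_mul, hω.div_self]

variable (h1 : 1 ≤ ω)
include h1

theorem len_add_len_dual {A : Submodule R K} (hA : IsNonzeroFractional A) (hA1 : 1 ≤ A)
    (hωA : ω * A = A) : len ω 1 + len 1 (dual A) = len A 1 := by
  rw [← hω.len_div_div hA .one hA1, div_one_eq, hω.div_eq_dual hωA,
    len_add (C := dual A) hω.isNonzeroFractional (.div .one hA) h1 (dual_le_one hA1)]

variable [Module.Finite R (integralClosure R K)] (hω' : ω ≤ Rbar R K)
include hω'

theorem len_Rbar : len (Rbar R K) ω = numTS R K := by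
  rw [← hω.len_div_div isNonzeroFractional_Rbar hω.isNonzeroFractional hω', hω.div_self,
    hω.div_Rbar h1 hω', numTS]

variable [IsDiscreteValuationRing (integralClosure R K)]

theorem isAlmostGorenstein_iff_typeSeq :
    IsAlmostGorenstein R K ↔ typeSeq R K 1 = len ω 1 + 1 := by
  have delta_eq : delta R K = numTS R K + len ω 1 := by
    rw [delta, len_add isNonzeroFractional_Rbar .one hω' h1, hω.len_Rbar h1 hω']
  have cond_eq : cond R K = delta R K + numTS R K :=
    len_add isNonzeroFractional_Rbar isNonzeroFractional_condIdeal one_le_Rbar condIdeal_le_one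
  rw [IsAlmostGorenstein]
  omega

theorem isAlmostGorenstein_iff_mul_frac [IsLocalRing R] (hm : maximalIdeal R ≠ ⊥) :
    IsAlmostGorenstein R K ↔ ω * frac K (maximalIdeal R) = frac K (maximalIdeal R) := by
  have hM := isNonzeroFractional_frac (K := K) hm
  have hωF := hω.isNonzeroFractional
  have le_mul : frac K (maximalIdeal R) ≤ ω * frac K (maximalIdeal R) := le_mul_of_one_le_left' h1
  have len_via_one := len_add hωF hM h1 (frac_le_one _)
  have len_via_mul := len_add hωF hM (mul_le_of_le_one_right' (frac_le_one _)) le_mul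
  rw [(len_eq_one_iff .one hM (frac_le_one _)).2 frac_maximalIdeal_covBy_one] at len_via_one
  rw [hω.len_mul_frac hm, ← typeSeq_one] at len_via_mul
  rw [hω.isAlmostGorenstein_iff_typeSeq h1 hω']
  refine ⟨fun h => (eq_of_len_eq_zero (hωF.mul hM) hM le_mul (by omega)).symm, fun h => ?_⟩
  rw [h, len_self] at len_via_mul
  omega

end IsCanonicalIdeal

end Canonical

section Chain

section Algebra

variable {R A : Type*} [CommRing R] [CommRing A] [Algebra R A] {N : Submodule R A}

theorem pow_eq_pow_sup_span_singleton {a b : A} (ha : a ∈ N) (hb : b ∈ N)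
    (h : N ⊔ Submodule.span R {a * b} = N ^ 2) (n : ℕ) :
    N ^ (n + 2) = N ^ (n + 1) ⊔ Submodule.span R {a ^ (n + 1) * b} := by
  have span_mul_span (y z : A) : Submodule.span R {y} * Submodule.span R {z} =
      Submodule.span R {y * z} := by rw [Submodule.span_mul_span, Set.singleton_mul_singleton]
  have span_le {y : A} {L : Submodule R A} (hy : y ∈ L) : Submodule.span R {y} ≤ L :=
    (Submodule.span_singleton_le_iff_mem _ _).2 hy
  have pow_mem (n : ℕ) : a ^ n ∈ N ^ n := Submodule.pow_mem_pow N ha n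
  refine le_antisymm ?_ (sup_le ?_ (span_le (Submodule.mul_mem_mul (pow_mem (n + 1)) hb)))
  · induction n with
    | zero => rw [zero_add, zero_add, pow_one, pow_one, h]
    | succ n ih =>
      calc N ^ (n + 3) ≤ (N ^ (n + 1) ⊔ Submodule.span R {a ^ (n + 1) * b}) * N :=
            (pow_succ N (n + 2)).trans_le (mul_le_mul_left ih N)
        _ = N ^ (n + 2) ⊔ Submodule.span R {a ^ (n + 1)} * (Submodule.span R {b} * N) := by
            rw [Submodule.sup_mul, ← pow_succ, ← span_mul_span, mul_assoc]
        _ ≤ N ^ (n + 2) ⊔ Submodule.span R {a ^ (n + 1)} * (N ⊔ Submodule.span R {a * b}) := by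
            rw [h, sq]
            gcongr
            exact span_le hb
        _ = N ^ (n + 2) ⊔ Submodule.span R {a ^ (n + 1)} * N ⊔
              Submodule.span R {a ^ (n + 2) * b} := by
            rw [Submodule.mul_sup, span_mul_span, ← mul_assoc, ← pow_succ, sup_assoc]
        _ ≤ N ^ (n + 2) ⊔ Submodule.span R {a ^ (n + 2) * b} := by
            refine sup_le_sup_right (sup_le le_rfl ?_) _
            rw [pow_succ N]
            exact mul_le_mul_left (span_le (pow_mem _)) N
  · rw [pow_succ, pow_add]
    exact mul_le_mul_right (le_sup_left.trans_eq h) (N ^ n)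

theorem ne_one_of_covBy_sq (h : N ⋖ N ^ 2) : N ≠ 1 := by
  rintro rfl
  exact h.lt.ne (one_pow 2).symm

variable [IsLocalRing R]

theorem pow_wcovBy_pow_succ_of_covBy_sq (h : N ⋖ N ^ 2) (n : ℕ) : N ^ (n + 1) ⩿ N ^ (n + 2) := by
  have exists_mul_notMem : ∃ a ∈ N, ∃ b ∈ N, a * b ∉ N := by
    by_contra! hN
    exact h.lt.not_ge (by rwa [sq, Submodule.mul_le])
  obtain ⟨a, ha, b, hb, hab⟩ := exists_mul_notMem
  have hab2 : a * b ∈ N ^ 2 := by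
    rw [sq]
    exact Submodule.mul_mem_mul ha hb
  rw [pow_eq_pow_sup_span_singleton ha hb (sup_span_singleton_eq_of_covBy h hab2 hab)]
  refine wcovBy_sup_span_singleton fun r hr => ?_
  have smul_eq : r • (a ^ (n + 1) * b) = a ^ n * r • (a * b) := by
    rw [mul_smul_comm, pow_succ, mul_assoc]
  rw [smul_eq, pow_succ N]
  exact Submodule.mul_mem_mul (Submodule.pow_mem_pow N ha _) (smul_mem_of_covBy h hr hab2)

end Algebra

variable {R : Type*} [CommRing R] [IsDomain R] [IsNoetherianRing R] {K : Type*} [Field K]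
  [Algebra R K] [IsFractionRing R K]

namespace IsPrincipalReduction

variable {I : Ideal R} {x : R}

section Blowup

variable [Module.Finite R (integralClosure R K)] (hx : IsPrincipalReduction K I x)
include hx

theorem one_le_blowup : 1 ≤ blowup K I := by
  rw [hx.blowup_eq_pow_reductionExponent]
  exact hx.one_le_pow _

theorem blowup_le_Rbar : blowup K I ≤ Rbar R K := by
  rw [hx.blowup_eq_pow_reductionExponent]
  exact hx.pow_le_Rbar _

theorem isNonzeroFractional_blowup : IsNonzeroFractional (blowup K I) := by
  rw [hx.blowup_eq_pow_reductionExponent]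
  exact hx.isNonzeroFractional_scaled.pow _

theorem scaled_mul_blowup : scaled K I x * blowup K I = blowup K I := by
  rw [hx.blowup_eq_pow_reductionExponent, ← pow_succ', hx.pow_reductionExponent_succ]

theorem frac_pow_le_dual_blowup : frac K I ^ reductionExponent I ≤ dual (blowup K I) := by
  rw [le_dual_iff, hx.blowup_eq_pow_reductionExponent, ← hx.span_pow_mul_pow, mul_assoc,
    ← pow_add, pow_eq_of_pow_succ_eq hx.pow_reductionExponent_succ (Nat.le_add_left _ _),
    hx.span_pow_mul_pow]
  exact pow_le_one' (frac_le_one _) _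

variable (hN : scaled K I x ⋖ scaled K I x ^ 2)
include hN

theorem two_le_reductionExponent : 2 ≤ reductionExponent I := by
  by_contra! h
  have hk := hx.pow_reductionExponent_succ
  have sq_eq : scaled K I x ^ 2 = scaled K I x ^ 1 :=
    (pow_eq_of_pow_succ_eq hk (by omega)).trans (pow_eq_of_pow_succ_eq hk (by omega)).symm
  exact hN.lt.ne (by rw [sq_eq, pow_one])

theorem scaled_sq_le_blowup : scaled K I x ^ 2 ≤ blowup K I := by
  rw [hx.blowup_eq_pow_reductionExponent]
  exact hx.pow_mono (hx.two_le_reductionExponent hN)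

variable [IsLocalRing R] [Ring.KrullDimLE 1 R]

theorem len_scaled_pow {n : ℕ} (hn : n < reductionExponent I) :
    len (scaled K I x ^ (n + 1)) (scaled K I x) = n := by
  have fractional (k : ℕ) := hx.isNonzeroFractional_scaled.pow k
  induction n with
  | zero => rw [zero_add, pow_one, len_self]
  | succ n ih =>
    have covBy : scaled K I x ^ (n + 1) ⋖ scaled K I x ^ (n + 2) :=
      (pow_wcovBy_pow_succ_of_covBy_sq hN n).covBy_of_ne (hx.pow_succ_ne hn).symm
    rw [len_add (B := scaled K I x ^ (n + 1)) (fractional _) hx.isNonzeroFractional_scaled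
      covBy.le (le_self_pow hx.one_le (by omega)), ih (by omega),
      (len_eq_one_iff (fractional _) (fractional _) covBy.le).2 covBy, add_comm]

theorem len_blowup_scaled : len (blowup K I) (scaled K I x) + 1 = reductionExponent I := by
  have two_le := hx.two_le_reductionExponent hN
  obtain ⟨n, hn⟩ := Nat.exists_eq_succ_of_ne_zero (n := reductionExponent I) (by omega)
  rw [hx.blowup_eq_pow_reductionExponent, hn, Nat.succ_eq_add_one,
    hx.len_scaled_pow hN (by omega)]

end Blowup

end IsPrincipalReduction

end Chain

section MaximalIdeal

theorem mul_le_of_covBy {R A : Type*} [CommRing R] [CommRing A] [Algebra R A]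
    {P N L : Submodule R A} (h : N ⋖ L) (hPN : P * N ≤ N) (hPL : P * L ≤ L) {c : ℕ}
    (hc : P ^ c * L ≤ N) : P * L ≤ N := by
  rcases h.eq_or_eq le_sup_right (sup_le hPL h.le) with he | he
  · exact sup_eq_right.1 he
  have le_pow_mul_sup (j : ℕ) : L ≤ P ^ j * L ⊔ N := by
    induction j with
    | zero => rw [pow_zero, one_mul]; exact le_sup_left
    | succ j ih =>
      calc L ≤ P * (P ^ j * L ⊔ N) ⊔ N := he.ge.trans (sup_le_sup_right (mul_le_mul_right ih P) N)
        _ = P ^ (j + 1) * L ⊔ (P * N ⊔ N) := by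
          rw [Submodule.mul_sup, ← mul_assoc, ← pow_succ', sup_assoc]
        _ = P ^ (j + 1) * L ⊔ N := by rw [sup_eq_right.2 hPN]
  exact (h.lt.not_ge ((le_pow_mul_sup c).trans (sup_le hc le_rfl))).elim

variable {R : Type*} [CommRing R] [IsLocalRing R] {K : Type*} [Field K] [Algebra R K]

theorem le_frac_maximalIdeal {C : Submodule R K} (hC : C ≤ 1) (hC1 : C ≠ 1) :
    C ≤ frac K (maximalIdeal R) := by
  intro w hw
  obtain ⟨r, rfl⟩ := Submodule.mem_one.1 (hC hw)
  refine algebraMap_mem_frac ((mem_maximalIdeal r).2 fun hr => hC1 (hC.antisymm ?_))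
  rw [Submodule.one_le, ← C.smul_mem_iff_of_isUnit hr, ← Algebra.algebraMap_eq_smul_one]
  exact hw

section PositiveDual

variable [IsDiscreteValuationRing (integralClosure R K)]

variable (R K) in
/-- The elements of positive value in `R : 𝔪`. When `R : 𝔪` is a ring, they form its maximal
ideal. -/
def positiveDual : Submodule R K := dual (frac K (maximalIdeal R)) ⊓ valFil R K 1

variable [IsDomain R] [IsFractionRing R K]

theorem frac_maximalIdeal_le_positiveDual : frac K (maximalIdeal R) ≤ positiveDual R K :=
  le_inf ((frac_le_one _).trans (one_le_dual_frac _)) (frac_maximalIdeal.trans_le inf_le_right)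

theorem positiveDual_covBy (hrat : ResiduallyRational R K)
    (h : dual (frac K (maximalIdeal R)) ≤ Rbar R K) :
    positiveDual R K ⋖ dual (frac K (maximalIdeal R)) := by
  have := inf_valFil_succ_covBy hrat
    (values_mono (one_le_dual_frac (maximalIdeal R)) zero_mem_values_one)
  rwa [zero_add, valFil_zero, inf_eq_left.2 h] at this

variable [IsNoetherianRing R]

theorem isNonzeroFractional_positiveDual (hm : maximalIdeal R ≠ ⊥) :
    IsNonzeroFractional (positiveDual R K) :=
  .of_le_of_le (isNonzeroFractional_frac hm) frac_maximalIdeal_le_positiveDual inf_le_left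
    (.div .one (isNonzeroFractional_frac hm))

variable [Module.Finite R (integralClosure R K)]

/- If `R : 𝔪 = R`, then `R : 𝔪 ^ c = R` for every `c`, although `𝔪 ^ c` lies in the conductor
for large `c`. -/
theorem one_lt_dual_frac_maximalIdeal (h : ¬ Rbar R K ≤ 1) :
    1 < dual (frac K (maximalIdeal R)) := by
  refine lt_of_le_of_ne (one_le_dual_frac _) fun he => h ?_
  obtain ⟨c, hc⟩ := exists_condIdeal_eq_valFil R K
  have pow_le : frac K (maximalIdeal R) ^ c ≤ condIdeal R K := by
    rw [hc, frac_maximalIdeal]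
    exact (pow_le_pow_left' inf_le_right c).trans (valFil_one_pow_le c)
  have dual_pow (n : ℕ) : dual (frac K (maximalIdeal R) ^ n) = 1 := by
    induction n with
    | zero => rw [pow_zero, dual_one]
    | succ n ih =>
      rw [pow_succ, dual, div_mul_eq, ← dual, ih]
      exact he.symm
  rw [← dual_condIdeal, ← dual_pow c]
  exact div_anti_right 1 pow_le

end PositiveDual

variable [IsDomain R] [IsNoetherianRing R] [IsFractionRing R K]
  [Module.Finite R (integralClosure R K)] {x : R}

namespace IsPrincipalReduction

variable (hx : IsPrincipalReduction K (maximalIdeal R) x)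
include hx

section NeOne

variable (hN : scaled K (maximalIdeal R) x ≠ 1)
include hN

/- If `(R : 𝔪) 𝔪 = R`, then `x⁻¹𝔪` is invertible, and `(x⁻¹𝔪) ^ (ν + 1) = (x⁻¹𝔪) ^ ν` gives
`x⁻¹𝔪 = R`. -/
theorem dual_mul_frac_le :
    dual (frac K (maximalIdeal R)) * frac K (maximalIdeal R) ≤ frac K (maximalIdeal R) := by
  refine le_frac_maximalIdeal (dual_mul_le_one _) fun h => hN ?_
  have isUnit : IsUnit (scaled K (maximalIdeal R) x) := by
    refine IsUnit.of_mul_eq_one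
      (Submodule.span R {algebraMap R K x} * dual (frac K (maximalIdeal R))) ?_
    rw [mul_left_comm, ← mul_assoc, hx.span_mul_scaled, mul_comm, h]
  have pow_succ_eq := hx.pow_reductionExponent_succ
  rwa [pow_succ, (isUnit.pow _).mul_eq_left] at pow_succ_eq

theorem dual_le_scaled : dual (frac K (maximalIdeal R)) ≤ scaled K (maximalIdeal R) x := by
  rw [scaled, ← span_singleton_mul_le_iff hx.algebraMap_ne_zero, mul_comm]
  exact (mul_le_mul_right ((Submodule.span_singleton_le_iff_mem _ _).2
    (algebraMap_mem_frac hx.mem)) _).trans (hx.dual_mul_frac_le hN)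

theorem dual_mul_scaled_le : dual (frac K (maximalIdeal R)) * scaled K (maximalIdeal R) x ≤
    scaled K (maximalIdeal R) x := by
  rw [scaled, mul_left_comm]
  exact mul_le_mul_right (hx.dual_mul_frac_le hN) _

theorem dual_le_Rbar : dual (frac K (maximalIdeal R)) ≤ Rbar R K :=
  (hx.dual_le_scaled hN).trans hx.scaled_le

theorem dual_blowup_le_frac :
    dual (blowup K (maximalIdeal R)) ≤ frac K (maximalIdeal R) := by
  refine le_frac_maximalIdeal (dual_le_one hx.one_le_blowup) fun h => hN (le_antisymm ?_ hx.one_le)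
  calc scaled K (maximalIdeal R) x
      ≤ scaled K (maximalIdeal R) x * blowup K (maximalIdeal R) :=
        le_mul_of_one_le_right' hx.one_le_blowup
    _ = dual (blowup K (maximalIdeal R)) * blowup K (maximalIdeal R) := by
        rw [hx.scaled_mul_blowup, h, one_mul]
    _ ≤ 1 := dual_mul_le_one _

end NeOne

variable [IsDiscreteValuationRing (integralClosure R K)]

variable (hN : scaled K (maximalIdeal R) x ⋖ scaled K (maximalIdeal R) x ^ 2)
include hN

/- Elements of positive value in `R : 𝔪` act nilpotently, hence trivially, on the simple module
`x⁻²𝔪² / x⁻¹𝔪`. -/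
theorem positiveDual_mul_scaled_sq_le :
    positiveDual R K * scaled K (maximalIdeal R) x ^ 2 ≤ scaled K (maximalIdeal R) x := by
  have mul_scaled_le : positiveDual R K * scaled K (maximalIdeal R) x ≤
      scaled K (maximalIdeal R) x :=
    (mul_le_mul_left inf_le_left _).trans (hx.dual_mul_scaled_le (ne_one_of_covBy_sq hN))
  obtain ⟨c, hc⟩ := exists_condIdeal_eq_valFil R K
  refine mul_le_of_covBy hN mul_scaled_le ?_ (c := c) ?_
  · rw [sq, ← mul_assoc]
    exact mul_le_mul_left mul_scaled_le _
  · calc positiveDual R K ^ c * scaled K (maximalIdeal R) x ^ 2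
        ≤ condIdeal R K * Rbar R K := by
          rw [hc]
          exact mul_le_mul' ((pow_le_pow_left' inf_le_right c).trans (valFil_one_pow_le c))
            (hx.pow_le_Rbar 2)
      _ ≤ scaled K (maximalIdeal R) x :=
          (condIdeal_mul_Rbar_le.trans condIdeal_le_one).trans hx.one_le

theorem positiveDual_mul_scaled_le :
    positiveDual R K * scaled K (maximalIdeal R) x ≤ positiveDual R K := by
  refine le_inf ?_ ((mul_le_mul' inf_le_right hx.scaled_le).trans (valFil_mul_Rbar_le 1))
  rw [le_dual_iff]
  calc positiveDual R K * scaled K (maximalIdeal R) x * frac K (maximalIdeal R)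
      = Submodule.span R {algebraMap R K x} *
          (positiveDual R K * scaled K (maximalIdeal R) x ^ 2) := by
        rw [← hx.span_mul_scaled]
        ring
    _ ≤ Submodule.span R {algebraMap R K x} * scaled K (maximalIdeal R) x :=
        mul_le_mul_right (hx.positiveDual_mul_scaled_sq_le hN) _
    _ ≤ 1 := hx.span_mul_scaled.trans_le (frac_le_one _)

theorem positiveDual_mul_blowup_le :
    positiveDual R K * blowup K (maximalIdeal R) ≤ positiveDual R K := by
  have mul_pow_le (n : ℕ) :
      positiveDual R K * scaled K (maximalIdeal R) x ^ n ≤ positiveDual R K := by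
    induction n with
    | zero => rw [pow_zero, mul_one]
    | succ n ih =>
      rw [pow_succ, ← mul_assoc]
      exact (mul_le_mul_left ih _).trans (hx.positiveDual_mul_scaled_le hN)
  rw [hx.blowup_eq_pow_reductionExponent]
  exact mul_pow_le _

theorem span_mul_blowup_not_le_one :
    ¬ Submodule.span R {algebraMap R K x} * blowup K (maximalIdeal R) ≤ 1 := fun h => by
  have span_le : Submodule.span R {algebraMap R K x} ≤ valFil R K 1 :=
    (Submodule.span_singleton_le_iff_mem _ _).2
      (frac_maximalIdeal_le_positiveDual (algebraMap_mem_frac hx.mem)).2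
  have le_frac : Submodule.span R {algebraMap R K x} * blowup K (maximalIdeal R) ≤
      frac K (maximalIdeal R) := by
    rw [frac_maximalIdeal]
    exact le_inf h ((mul_le_mul' span_le hx.blowup_le_Rbar).trans (valFil_mul_Rbar_le 1))
  rw [span_singleton_mul_le_iff hx.algebraMap_ne_zero] at le_frac
  exact hN.lt.not_ge ((hx.scaled_sq_le_blowup hN).trans le_frac)

variable (hrat : ResiduallyRational R K)
include hrat

theorem span_mul_positiveDual_covBy :
    Submodule.span R {algebraMap R K x} * positiveDual R K ⋖
      dual (scaled K (maximalIdeal R) x) := by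
  rw [hx.dual_scaled]
  exact (apply_covBy_apply_iff (spanSingletonMulIso hx.algebraMap_ne_zero)).2
    (positiveDual_covBy hrat (hx.dual_le_Rbar (ne_one_of_covBy_sq hN)))

theorem dual_blowup_eq :
    dual (blowup K (maximalIdeal R)) =
      Submodule.span R {algebraMap R K x} * positiveDual R K := by
  have covBy := hx.span_mul_positiveDual_covBy hN hrat
  refine (covBy.eq_or_eq ?_ ?_).resolve_right fun h => hx.span_mul_blowup_not_le_one hN ?_
  · rw [le_dual_iff, mul_assoc]
    exact ((mul_le_mul_right (hx.positiveDual_mul_blowup_le hN) _).trans covBy.le).trans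
      (dual_le_one hx.one_le)
  · exact div_anti_right 1 (hN.le.trans (hx.scaled_sq_le_blowup hN))
  · rw [← le_dual_iff, h, hx.dual_scaled]
    exact le_mul_of_one_le_right' (one_le_dual_frac _)

variable [Ring.KrullDimLE 1 R]

theorem len_one_dual_blowup :
    len 1 (dual (blowup K (maximalIdeal R))) + len (dual (frac K (maximalIdeal R))) 1 =
      len 1 (Submodule.span R {algebraMap R K x}) + 1 := by
  have hX : IsNonzeroFractional (Submodule.span R {algebraMap R K x}) :=
    .span_singleton hx.algebraMap_ne_zero
  have hXP := hX.mul (isNonzeroFractional_positiveDual (K := K) hx.ideal_ne_bot)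
  have dual_scaled_le : dual (scaled K (maximalIdeal R) x) ≤ 1 := dual_le_one hx.one_le
  have hB : IsNonzeroFractional (dual (scaled K (maximalIdeal R) x)) :=
    .div .one hx.isNonzeroFractional_scaled
  have covBy := hx.span_mul_positiveDual_covBy hN hrat
  have span_le : Submodule.span R {algebraMap R K x} ≤ dual (scaled K (maximalIdeal R) x) := by
    rw [hx.dual_scaled]
    exact le_mul_of_one_le_right' (one_le_dual_frac _)
  have len_dual_span : len (dual (scaled K (maximalIdeal R) x))
      (Submodule.span R {algebraMap R K x}) = len (dual (frac K (maximalIdeal R))) 1 := by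
    have := len_span_singleton_mul hx.algebraMap_ne_zero (dual (frac K (maximalIdeal R))) 1
    rwa [mul_one, ← hx.dual_scaled] at this
  rw [hx.dual_blowup_eq hN hrat, len_add .one hXP dual_scaled_le covBy.le,
    (len_eq_one_iff hB hXP covBy.le).2 covBy, ← len_dual_span,
    len_add .one hX dual_scaled_le span_le]
  omega

end IsPrincipalReduction

end MaximalIdeal

section AlmostMaximalMultiplicity

variable {R : Type*} [CommRing R] [IsDomain R] [IsNoetherianRing R] [IsLocalRing R]
  {K : Type*} [Field K] [Algebra R K] [IsFractionRing R K]

theorem frac_maximalIdeal_pow_strictAnti (hm : maximalIdeal R ≠ ⊥) :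
    StrictAnti fun n => frac K (maximalIdeal R) ^ n := by
  refine strictAnti_nat_of_succ_lt fun n => lt_of_le_of_ne
    (pow_le_pow_right_of_le_one' (frac_le_one _) n.le_succ) fun h => pow_ne_zero n hm ?_
  rw [← frac_pow, ← frac_pow] at h
  refine Submodule.eq_bot_of_le_smul_of_le_jacobson_bot (maximalIdeal R) _
    (IsNoetherian.noetherian _) ?_ (IsLocalRing.maximalIdeal_le_jacobson _)
  rw [smul_eq_mul, ← pow_succ', frac_injective h]

namespace IsPrincipalReduction

variable [Ring.KrullDimLE 1 R] {x : R} (hx : IsPrincipalReduction K (maximalIdeal R) x)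
include hx

theorem len_one_frac : len 1 (frac K (maximalIdeal R)) = 1 :=
  (len_eq_one_iff .one (isNonzeroFractional_frac hx.ideal_ne_bot)
    frac_maximalIdeal_covBy_one.le).2 frac_maximalIdeal_covBy_one

theorem len_scaled_one :
    len (scaled K (maximalIdeal R) x) 1 + 1 = len 1 (Submodule.span R {algebraMap R K x}) := by
  have := hx.hilbertFun_add_len 0
  rwa [hilbertFun_eq_len (K := K), zero_add, pow_zero, pow_one, pow_one, hx.len_one_frac,
    add_comm] at this

theorem len_one_frac_sq
    (hN : scaled K (maximalIdeal R) x ⋖ scaled K (maximalIdeal R) x ^ 2) :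
    len 1 (frac K (maximalIdeal R) ^ 2) =
    len 1 (Submodule.span R {algebraMap R K x}) := by
  have hM := isNonzeroFractional_frac (K := K) hx.ideal_ne_bot
  have len_sq := (len_eq_one_iff (hx.isNonzeroFractional_scaled.pow 2)
    hx.isNonzeroFractional_scaled hN.le).2 hN
  have := hx.hilbertFun_add_len 1
  rw [hilbertFun_eq_len (K := K), pow_one, pow_one, one_add_one_eq_two, len_sq] at this
  rw [len_add .one (hM.pow 2) (frac_le_one _)
      ((sq _).trans_le (mul_le_of_le_one_right' (frac_le_one _))), hx.len_one_frac, ← this,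
    add_comm]

variable [Module.Finite R (integralClosure R K)]

theorem scaled_covBy_sq (he : mult (maximalIdeal R) = (embDim R : ℤ) + 1) :
    scaled K (maximalIdeal R) x ⋖ scaled K (maximalIdeal R) x ^ 2 := by
  rw [hx.mult_eq, embDim_eq_hilbertFun, ← hx.hilbertFun_add_len 1, pow_one] at he
  have le_sq := le_self_pow hx.one_le two_ne_zero
  rw [← len_eq_one_iff (hx.isNonzeroFractional_scaled.pow 2) hx.isNonzeroFractional_scaled le_sq]
  push_cast at he
  linarith

theorem one_mem_Icc_sdiff_Gam [IsDiscreteValuationRing (integralClosure R K)]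
    (hN : scaled K (maximalIdeal R) x ≠ 1) :
    1 ∈ Finset.Icc 1 (numTS R K) \ Gam K (maximalIdeal R) := by
  classical
  have numTS_ne_zero : numTS R K ≠ 0 := fun h0 => by
    have condIdeal_eq : condIdeal R K = 1 :=
      eq_of_len_eq_zero .one isNonzeroFractional_condIdeal condIdeal_le_one h0
    refine hx.not_Rbar_le_one hN ?_
    rw [← dual_condIdeal, condIdeal_eq, dual_one]
  have dual_le : dual (blowup K (maximalIdeal R)) ≤ valFil R K 1 :=
    (hx.dual_blowup_le_frac hN).trans ((frac_maximalIdeal (K := K)).trans_le inf_le_right)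
  rw [Finset.mem_sdiff, Finset.mem_Icc, Gam, Finset.mem_filter]
  refine ⟨⟨le_rfl, by omega⟩, fun ⟨_, y, hy, hy0⟩ => ?_⟩
  have one_le := coe_mem_valFil.1 (dual_le hy)
  rw [hy0, Nat.sub_self, sElem, Nat.nth_zero_of_zero zero_mem_values_one] at one_le
  exact absurd one_le (by norm_num)

variable (hN : scaled K (maximalIdeal R) x ⋖ scaled K (maximalIdeal R) x ^ 2)
include hN

theorem len_blowup_one : len (blowup K (maximalIdeal R)) 1 + 2 =
    len 1 (Submodule.span R {algebraMap R K x}) + reductionExponent (maximalIdeal R) := by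
  rw [len_add (B := scaled K (maximalIdeal R) x) hx.isNonzeroFractional_blowup .one
    ((hN.le).trans (hx.scaled_sq_le_blowup hN)) hx.one_le, ← hx.len_scaled_one,
    ← hx.len_blowup_scaled hN]
  omega

variable [IsDiscreteValuationRing (integralClosure R K)] (hrat : ResiduallyRational R K)
include hrat

theorem dual_blowup_eq_frac_pow_iff :
    dual (blowup K (maximalIdeal R)) =
        frac K (maximalIdeal R) ^ reductionExponent (maximalIdeal R) ↔
      IsGorenstein R K ∧ reductionExponent (maximalIdeal R) = 2 := by
  have hM := isNonzeroFractional_frac (K := K) hx.ideal_ne_bot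
  have not_Rbar_le_one := hx.not_Rbar_le_one (ne_one_of_covBy_sq hN)
  have len_one_dual := hx.len_one_dual_blowup hN hrat
  have dual_le : dual (blowup K (maximalIdeal R)) ≤ 1 := dual_le_one hx.one_le_blowup
  have hD : IsNonzeroFractional (dual (blowup K (maximalIdeal R))) :=
    .div .one hx.isNonzeroFractional_blowup
  rw [isGorenstein_iff_len_dual hx.ideal_ne_bot]
  constructor
  · intro h
    have pow_le_sq : frac K (maximalIdeal R) ^ reductionExponent (maximalIdeal R) ≤
        frac K (maximalIdeal R) ^ 2 :=
      (frac_maximalIdeal_pow_strictAnti hx.ideal_ne_bot).antitone (hx.two_le_reductionExponent hN)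
    have len_dual_ne_zero : len (dual (frac K (maximalIdeal R))) 1 ≠ 0 := fun h0 =>
      (one_lt_dual_frac_maximalIdeal not_Rbar_le_one).ne
        (eq_of_len_eq_zero (.div .one hM) .one (one_le_dual_frac _) h0)
    rw [h, len_add .one (hM.pow _) (pow_le_one' (frac_le_one _) 2) pow_le_sq,
      hx.len_one_frac_sq hN] at len_one_dual
    have pow_eq_sq : frac K (maximalIdeal R) ^ reductionExponent (maximalIdeal R) =
        frac K (maximalIdeal R) ^ 2 :=
      eq_of_len_eq_zero (hM.pow 2) (hM.pow _) pow_le_sq (by omega)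
    exact ⟨by omega, (frac_maximalIdeal_pow_strictAnti hx.ideal_ne_bot).injective pow_eq_sq⟩
  · rintro ⟨len_dual, hν⟩
    have sq_le := hx.frac_pow_le_dual_blowup
    rw [hν] at sq_le ⊢
    have len_sq := len_add .one (hM.pow 2) dual_le sq_le
    rw [hx.len_one_frac_sq hN] at len_sq
    exact (eq_of_len_eq_zero hD (hM.pow 2) sq_le (by omega)).symm

theorem sum_erase_typeSeq_sub_one :
    ∑ i ∈ (Finset.Icc 1 (numTS R K) \ Gam K (maximalIdeal R)).erase 1,
        ((typeSeq R K i : ℤ) - 1) =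
      dInv K (maximalIdeal R) + (len (dual (dual (blowup K (maximalIdeal R))))
        (blowup K (maximalIdeal R)) : ℤ) + ((reductionExponent (maximalIdeal R) : ℤ) - 2) := by
  have len_blowup := hx.len_blowup_one hN
  have len_dual := hx.len_one_dual_blowup hN hrat
  rw [← typeSeq_one] at len_dual
  rw [Finset.sum_erase_eq_sub (hx.one_mem_Icc_sdiff_Gam (ne_one_of_covBy_sq hN)),
    sum_typeSeq_sub_one hrat _ hx.one_le_blowup hx.blowup_le_Rbar]
  omega

theorem isAlmostGorenstein_iff {ω : Submodule R K} (hω : IsCanonicalIdeal ω) (h1 : 1 ≤ ω)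
    (hω' : ω ≤ Rbar R K) :
    IsAlmostGorenstein R K ↔ reductionExponent (maximalIdeal R) = 2 ∧
      ω * blowup K (maximalIdeal R) = blowup K (maximalIdeal R) := by
  have mul_blowup_of_isAlmostGorenstein (hAG : IsAlmostGorenstein R K) :
      ω * blowup K (maximalIdeal R) = blowup K (maximalIdeal R) := by
    have mul_frac := (hω.isAlmostGorenstein_iff_mul_frac h1 hω' hx.ideal_ne_bot).1 hAG
    have mul_scaled : ω * scaled K (maximalIdeal R) x = scaled K (maximalIdeal R) x := by
      rw [scaled, mul_left_comm, mul_frac]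
    obtain ⟨n, hn⟩ := Nat.exists_eq_succ_of_ne_zero
      (two_pos.trans_le (hx.two_le_reductionExponent hN)).ne'
    rw [hx.blowup_eq_pow_reductionExponent, hn, pow_succ', ← mul_assoc, mul_scaled]
  have isAlmostGorenstein_iff_of_mul_blowup
      (h : ω * blowup K (maximalIdeal R) = blowup K (maximalIdeal R)) :
      IsAlmostGorenstein R K ↔ reductionExponent (maximalIdeal R) = 2 := by
    have len_ω := hω.len_add_len_dual h1 hx.isNonzeroFractional_blowup hx.one_le_blowup h
    have len_blowup := hx.len_blowup_one hN
    have len_dual := hx.len_one_dual_blowup hN hrat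
    rw [hω.isAlmostGorenstein_iff_typeSeq h1 hω', typeSeq_one]
    omega
  exact ⟨fun hAG => ⟨(isAlmostGorenstein_iff_of_mul_blowup
    (mul_blowup_of_isAlmostGorenstein hAG)).1 hAG, mul_blowup_of_isAlmostGorenstein hAG⟩,
    fun ⟨hν, h⟩ => (isAlmostGorenstein_iff_of_mul_blowup h).2 hν⟩

end IsPrincipalReduction

end AlmostMaximalMultiplicity

end CurveSing

end

open CurveSing IsLocalRing in
theorem corollary6p7_general
    {R : Type*} [CommRing R] [IsDomain R] [IsNoetherianRing R] [IsLocalRing R]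
    (hdim : ringKrullDim R = 1)
    {K : Type*} [Field K] [Algebra R K] [IsFractionRing R K]
    [Module.Finite R (integralClosure R K)]
    [IsDiscreteValuationRing (integralClosure R K)]
    (hrat : ResiduallyRational R K)
    (he : mult (maximalIdeal R) = (embDim R : ℤ) + 1) :
    (dual (blowup K (maximalIdeal R)) =
          frac K (maximalIdeal R) ^ reductionExponent (maximalIdeal R) ↔
        IsGorenstein R K ∧ reductionExponent (maximalIdeal R) = 2) ∧
      (∑ i ∈ (Finset.Icc 1 (numTS R K) \ Gam K (maximalIdeal R)).erase 1,
          ((typeSeq R K i : ℤ) - 1) =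
        dInv K (maximalIdeal R) +
          (len (dual (dual (blowup K (maximalIdeal R)))) (blowup K (maximalIdeal R)) : ℤ) +
          ((reductionExponent (maximalIdeal R) : ℤ) - 2)) ∧
      (∀ ω : Submodule R K, IsCanonicalIdeal ω → 1 ≤ ω → ω ≤ Rbar R K →
        (IsAlmostGorenstein R K ↔ reductionExponent (maximalIdeal R) = 2 ∧
          ω * blowup K (maximalIdeal R) = blowup K (maximalIdeal R))) := by
  have : Ring.KrullDimLE 1 R := Ring.krullDimLE_iff.2 hdim.le
  have hm : maximalIdeal R ≠ ⊥ := fun h => by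
    have := ringKrullDim_eq_zero_of_isField (isField_iff_maximalIdeal_eq.2 h)
    exact zero_ne_one (this.symm.trans hdim)
  obtain ⟨x, hx⟩ := exists_isPrincipalReduction (K := K) hm
  have hN := hx.scaled_covBy_sq he
  exact ⟨hx.dual_blowup_eq_frac_pow_iff hN hrat, hx.sum_erase_typeSeq_sub_one hN hrat,
    fun _ => hx.isAlmostGorenstein_iff hN hrat⟩

open CurveSing in
theorem corollary6p7
    {R : Type*} [CommRing R] [IsDomain R] [IsNoetherianRing R] [IsLocalRing R]
    (hdim : ringKrullDim R = 1)
    [Infinite (IsLocalRing.ResidueField R)]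
    {K : Type*} [Field K] [Algebra R K] [IsFractionRing R K]
    [Module.Finite R (integralClosure R K)]
    [IsDiscreteValuationRing (integralClosure R K)]
    (hrat : ResiduallyRational R K)
    (he : mult (IsLocalRing.maximalIdeal R) = (embDim R : ℤ) + 1) :
    (dual (blowup K (IsLocalRing.maximalIdeal R)) =
          frac K (IsLocalRing.maximalIdeal R) ^
            reductionExponent (IsLocalRing.maximalIdeal R) ↔
        IsGorenstein R K ∧ reductionExponent (IsLocalRing.maximalIdeal R) = 2) ∧
      (∑ i ∈ (Finset.Icc 1 (numTS R K) \ Gam K (IsLocalRing.maximalIdeal R)).erase 1,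
          ((typeSeq R K i : ℤ) - 1) =
        dInv K (IsLocalRing.maximalIdeal R) +
          (len (dual (dual (blowup K (IsLocalRing.maximalIdeal R))))
            (blowup K (IsLocalRing.maximalIdeal R)) : ℤ) +
          ((reductionExponent (IsLocalRing.maximalIdeal R) : ℤ) - 2)) ∧
      (∀ ω : Submodule R K, IsCanonicalIdeal ω → 1 ≤ ω → ω ≤ Rbar R K →
        (IsAlmostGorenstein R K ↔
          reductionExponent (IsLocalRing.maximalIdeal R) = 2 ∧
            ω * blowup K (IsLocalRing.maximalIdeal R) =
              blowup K (IsLocalRing.maximalIdeal R))) :=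
  corollary6p7_general hdim hrat he
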